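/- Let $a,b>0$ be real, let $\Phi_{a,b}(z)={}_1F_1(a;a+b;z)=\sum_{k\ge 0}\frac{(a)_k}{(a+b)_k}\frac{z^k}{k!}$ be the Kummer function, and let $(z_{a,b;k})_{k\ge 1}$ be any enumeration of its complex zeros (with multiplicity). Let $(\Gamma_k)_{k\ge1}$ be independent random variables on a probability space, each exponentially distributed with density $e^{-x}$ on $[0,\infty)$, and let $$\mathfrak{Z}_{a,b}=-\frac{a}{a+b}+\sum_{k=1}^{\infty}\frac{\Gamma_k-1}{z_{a,b;k}},$$ where the series denotes the limit of its partial sums. The series converges almost surely and all moments of $\mathfrak{Z}_{a,b}$ are finite, so that the hypergeometric Bernoulli polynomials $$B_n^{(a,b)}(x)=\mathbb{E}\left[(x+\mathfrak{Z}_{a,b})^n\right]\qquad(n\ge 0,\ x\in\mathbb{C})$$ are well defined. They satisfy $B_0^{(a,b)}(x)=1$ and, for all $n\ge 1$ and $x\in\mathbb{C}$, $$\sum_{k=0}^{n}\binom{a+b+n-1}{k}\binom{a-1+n-k}{a-1}B_k^{(a,b)}(x)=(a+b)_n\,\frac{x^n}{n!},$$ where $\binom{u}{v}=\frac{\Gamma(u+1)}{\Gamma(v+1)\Gamma(u-v+1)}$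 (here $\Gamma$ without an index is the gamma function) and $(c)_n=c(c+1)\cdots(c+n-1)$. -/

import Mathlib

open MeasureTheory ProbabilityTheory Filter Topology

/-- The Kummer function `Φ_{a,b}(z) = ₁F₁(a; a + b; z)`. Mathlib's hypergeometric function is
regularized (its coefficients carry the extra factor `1 / Γ(a + b)`), which is undone here. -/
noncomputable def kummerPhi (a b : ℝ) (z : ℂ) : ℂ :=
  Complex.Gamma ((a : ℂ) + b) * Complex.regularizedHGFun {(a : ℂ)} {(a : ℂ) + b} z

/-- The usual series `Φ_{a,b}(z) = ∑ (a)_k / (a + b)_k · z ^ k / k!`. -/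
theorem kummerPhi_eq_tsum {a b : ℝ} (hab : 0 < a + b) (z : ℂ) :
    kummerPhi a b z = ∑' k : ℕ, (ascPochhammer ℂ k).eval (a : ℂ) /
      (ascPochhammer ℂ k).eval ((a : ℂ) + b) * (z ^ k / (k.factorial : ℂ)) := by
  have hG : ∀ k : ℕ, Complex.Gamma ((a : ℂ) + b + k) =
      (ascPochhammer ℂ k).eval ((a : ℂ) + b) * Complex.Gamma ((a : ℂ) + b) := by
    intro k
    induction k with
    | zero => simp
    | succ k ih =>
      have hne : (a : ℂ) + b + k ≠ 0 := by
        have : (a : ℝ) + b + k ≠ 0 := by positivity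
        exact_mod_cast this
      rw [Nat.cast_succ, ← add_assoc, Complex.Gamma_add_one _ hne, ih]
      simp [ascPochhammer_succ_right]
      ring
  have h0 : Complex.Gamma ((a : ℂ) + b) ≠ 0 :=
    Complex.Gamma_ne_zero_of_re_pos (by simpa using hab)
  rw [kummerPhi, Complex.regularizedHGFun, Complex.regularizedHGFunSeries,
    ← FormalMultilinearSeries.ofScalarsSum, FormalMultilinearSeries.ofScalarsSum_eq_tsum,
    ← tsum_mul_left]
  refine tsum_congr fun k => ?_
  simp only [Complex.regularizedHGFunCoeff, Multiset.map_singleton, Multiset.prod_singleton,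
    hG, smul_eq_mul]
  field_simp

/-- `ζ 0, ζ 1, …` lists the zeros of `Φ_{a,b}`, each one as often as its multiplicity
(points where `Φ_{a,b}` does not vanish have order `0`, so they do not occur). -/
def IsKummerZeroEnumeration (a b : ℝ) (ζ : ℕ → ℂ) : Prop :=
  ∀ w : ℂ, {k : ℕ | ζ k = w}.encard = analyticOrderAt (kummerPhi a b) w

/-- The partial sums of the series defining the random variable `𝔷_{a,b}`. -/
noncomputable def zPartialSum {Ω : Type*} (a b : ℝ) (ζ : ℕ → ℂ) (Γ : ℕ → Ω → ℝ)
    (N : ℕ) (ω : Ω) : ℂ :=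
  -((a : ℂ) / ((a : ℂ) + b)) + ∑ k ∈ Finset.range N, ((Γ k ω : ℂ) - 1) / ζ k

/-- The complex random variable `𝔷_{a,b} = -a/(a+b) + ∑_k (Γ_k - 1) / ζ_k`, the series being the
limit of its partial sums (it does not converge absolutely). -/
noncomputable def zVariable {Ω : Type*} (a b : ℝ) (ζ : ℕ → ℂ) (Γ : ℕ → Ω → ℝ) (ω : Ω) : ℂ :=
  limUnder atTop (fun N : ℕ => zPartialSum a b ζ Γ N ω)

/-- The hypergeometric Bernoulli polynomial `B_n^{(a,b)}(x) = 𝔼 (x + 𝔷_{a,b}) ^ n`. -/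
noncomputable def hypBernoulli {Ω : Type*} [MeasurableSpace Ω] (μ : Measure Ω) (a b : ℝ)
    (ζ : ℕ → ℂ) (Γ : ℕ → Ω → ℝ) (n : ℕ) (x : ℂ) : ℂ :=
  ∫ ω, (x + zVariable a b ζ Γ ω) ^ n ∂μ

/-- The binomial coefficient with real entries,
`binom(u, v) = Γ(u + 1) / (Γ(v + 1) Γ(u - v + 1))`. -/
noncomputable def realBinom (u v : ℝ) : ℝ :=
  Real.Gamma (u + 1) / (Real.Gamma (v + 1) * Real.Gamma (u - v + 1))

/-! If `X` is exponential with mean 1, then `𝔼 exp (s (X - 1)) = exp (-s) / (1 - s)`, the reciprocal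
of the Weierstrass factor `(1 - s) exp s`. With `s = t / ζ k`, independence turns the moment
generating function of the random series into the reciprocal of a Weierstrass product over the zeros
of `Φ`. By Hadamard (`EnumeratesZeros.hasProd`) that product is `Φ t * exp (-Φ'(0) t)`, and `Φ'(0) =
a / (a + b)` is the constant subtracted in `zVariable`. Hence `𝔼 exp (t Z) * Φ t = 1` near 0
(`exists_exponential_moments`, stated for the centred variable). Multiplying by `exp (t x)`,
comparing Taylor coefficients (`sum_antidiagonal_hypBernoulli`) and scaling by `(a + b)_n` gives the
recurrence.

Hadamard's theorem applies since `0 < (a)_k / (a + b)_k ≤ 1` forces `‖Φ z‖ ≤ exp ‖z‖`; a Jensen-type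
count then makes `∑ ‖ζ k‖⁻²` finite. This square summability also bounds the exponential moments of
the partial sums uniformly, which yields almost sure convergence (an L¹-bounded martingale), finite
moments (Fatou) and passage to the limit in the generating functions (uniform integrability). -/

/-! ### Dividing out and counting zeros of entire functions -/

/-- A zero of an entire function can be divided out. -/
theorem exists_entire_eq_one_sub_div_mul {f : ℂ → ℂ} (hf : Differentiable ℂ f) {w : ℂ}
    (hw : w ≠ 0) (hfw : f w = 0) :
    ∃ g : ℂ → ℂ, Differentiable ℂ g ∧ ∀ z, f z = (1 - z / w) * g z := by
  refine ⟨fun z => -w * dslope f w z, ?_, fun z => ?_⟩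
  · have : DifferentiableOn ℂ (dslope f w) Set.univ :=
      (Complex.differentiableOn_dslope univ_mem).2 hf.differentiableOn
    exact (differentiableOn_univ.1 this).const_mul _
  · have h := sub_smul_dslope f w z
    rw [hfw, sub_zero, smul_eq_mul] at h
    rw [← h]
    field_simp
    ring

theorem analyticOrderAt_one_sub_div {w : ℂ} (hw : w ≠ 0) (z : ℂ) :
    analyticOrderAt (fun z : ℂ => 1 - z / w) z = if w = z then 1 else 0 := by
  have han : AnalyticAt ℂ (fun z : ℂ => 1 - z / w) z := by fun_prop (disch := assumption)
  split_ifs with h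
  · subst h
    refine (han.analyticOrderAt_eq_natCast (n := 1)).2 ⟨fun _ => -w⁻¹, by fun_prop, ?_, ?_⟩
    · simpa using hw
    · refine Eventually.of_forall fun z => ?_
      simp only [pow_one, smul_eq_mul]
      field_simp
      ring
  · rw [han.analyticOrderAt_eq_zero, sub_ne_zero, ne_comm, Ne, div_eq_one_iff_eq hw]
    exact fun h' => h h'.symm

/-- `ζ` lists the zeros of `f` with multiplicity. -/
def EnumeratesZeros (f : ℂ → ℂ) (ζ : ℕ → ℂ) : Prop :=
  ∀ w : ℂ, {k : ℕ | ζ k = w}.encard = analyticOrderAt f w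

namespace EnumeratesZeros

variable {f : ℂ → ℂ} {ζ : ℕ → ℂ}

theorem eq_zero (h : EnumeratesZeros f ζ) (k : ℕ) : f (ζ k) = 0 := by
  have h1 := h (ζ k)
  by_contra h0
  rw [analyticOrderAt_eq_zero.2 (Or.inr h0), Set.encard_eq_zero] at h1
  exact (h1 ▸ (rfl : ζ k = ζ k) : k ∈ (∅ : Set ℕ))

theorem ne_zero (h : EnumeratesZeros f ζ) (h0 : f 0 ≠ 0) (k : ℕ) : ζ k ≠ 0 :=
  fun hk => h0 (hk ▸ h.eq_zero k)

/-- Dividing out finitely many listed zeros leaves an entire function with the other zeros. -/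
theorem exists_eq_prod_mul (h : EnumeratesZeros f ζ) (hf : Differentiable ℂ f) (h0 : f 0 ≠ 0)
    (S : Finset ℕ) :
    ∃ g : ℂ → ℂ, Differentiable ℂ g ∧ (∀ z, f z = (∏ k ∈ S, (1 - z / ζ k)) * g z) ∧
      ∀ w, {k : ℕ | k ∉ S ∧ ζ k = w}.encard = analyticOrderAt g w := by
  induction S using Finset.induction_on with
  | empty => exact ⟨f, hf, by simp, fun w => by simpa using h w⟩
  | insert i S hi ih =>
    obtain ⟨g, hg, hfg, hord⟩ := ih
    have hgi : g (ζ i) = 0 := by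
      by_contra hne
      have h1 := hord (ζ i)
      rw [analyticOrderAt_eq_zero.2 (Or.inr hne), Set.encard_eq_zero] at h1
      exact (h1 ▸ (⟨hi, rfl⟩ : i ∈ {k : ℕ | k ∉ S ∧ ζ k = ζ i}) : i ∈ (∅ : Set ℕ))
    have hζ := h.ne_zero h0 i
    obtain ⟨q, hq, hgq⟩ := exists_entire_eq_one_sub_div_mul hg hζ hgi
    refine ⟨q, hq, fun z => ?_, fun w => ?_⟩
    · rw [hfg, hgq, Finset.prod_insert hi]
      ring
    · have h1 := hord w
      have h2 : g = (fun z => 1 - z / ζ i) * q := funext hgq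
      rw [h2, analyticOrderAt_mul (by fun_prop (disch := assumption)) (hq.analyticAt w),
        analyticOrderAt_one_sub_div hζ] at h1
      split_ifs at h1 with hw
      -- At the removed zero both the index count and the order drop by one, and a finite 1 cancels
      -- in `ℕ∞`.
      · have h3 : {k : ℕ | k ∉ S ∧ ζ k = w} = insert i {k : ℕ | k ∉ insert i S ∧ ζ k = w} := by
          ext k
          by_cases hk : k = i <;> simp [hk, hi, hw]
        rw [h3, Set.encard_insert_of_notMem (by simp), add_comm] at h1
        exact WithTop.add_left_cancel WithTop.one_ne_top h1
      · rw [zero_add] at h1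
        rw [← h1]
        congr 1
        ext k
        by_cases hk : k = i <;> simp [hk, hi, hw]

end EnumeratesZeros

theorem norm_le_of_forall_norm_eq {g : ℂ → ℂ} (hg : Differentiable ℂ g) {r C : ℝ} (hr : 0 < r)
    (h : ∀ z, ‖z‖ = r → ‖g z‖ ≤ C) {z : ℂ} (hz : ‖z‖ ≤ r) : ‖g z‖ ≤ C := by
  refine Complex.norm_le_of_forall_mem_frontier_norm_le (U := Metric.ball 0 r)
    Metric.isBounded_ball hg.diffContOnCl (fun w hw => h w ?_) ?_
  · simpa [frontier_ball _ hr.ne'] using hw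
  · simpa [closure_ball _ hr.ne'] using hz

/-- Far outside the disc containing the zeros `w`, the factors are bounded below, so dividing by
them does not spoil an upper bound. -/
theorem le_norm_one_sub_div {z w : ℂ} {R c : ℝ} (hw0 : w ≠ 0) (hw : ‖w‖ ≤ R)
    (hz : ‖z‖ = (c + 1) * R) (hc : 0 ≤ c) : c ≤ ‖1 - z / w‖ := by
  have hw' : 0 < ‖w‖ := norm_pos_iff.2 hw0
  have h1 : c + 1 ≤ ‖z / w‖ := by
    rw [norm_div, le_div_iff₀ hw', hz]
    gcongr
  have h2 := norm_sub_norm_le (z / w) 1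
  rw [norm_one, norm_sub_rev] at h2
  linarith

section Hadamard

variable {f : ℂ → ℂ} {ζ : ℕ → ℂ}

/-- A bound, by the maximum principle, for what is left after dividing out zeros. -/
theorem norm_quotient_le (h0 : f 0 = 1)
    (hexp : ∀ z, ‖f z‖ ≤ Real.exp ‖z‖) (hz : EnumeratesZeros f ζ) {S : Finset ℕ} {R c : ℝ}
    (hR : 0 < R) (hS : ∀ k ∈ S, ‖ζ k‖ ≤ R) (hc : 0 < c) {g : ℂ → ℂ} (hg : Differentiable ℂ g)
    (hfg : ∀ z, f z = (∏ k ∈ S, (1 - z / ζ k)) * g z) {z : ℂ} (hzR : ‖z‖ ≤ (c + 1) * R) :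
    c ^ S.card * ‖g z‖ ≤ Real.exp ((c + 1) * R) := by
  rw [mul_comm, ← le_div_iff₀ (by positivity)]
  refine norm_le_of_forall_norm_eq hg (by positivity) (fun w hw => ?_) hzR
  rw [le_div_iff₀ (by positivity)]
  have h1 : c ^ S.card ≤ ‖∏ k ∈ S, (1 - w / ζ k)‖ := by
    rw [norm_prod, ← Finset.prod_const]
    exact Finset.prod_le_prod (fun _ _ => hc.le) fun k hk =>
      le_norm_one_sub_div (hz.ne_zero (by simp [h0]) k) (hS k hk) hw hc.le
  calc ‖g w‖ * c ^ S.card ≤ ‖g w‖ * ‖∏ k ∈ S, (1 - w / ζ k)‖ := by gcongr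
    _ = ‖f w‖ := by rw [hfg, norm_mul, mul_comm]
    _ ≤ _ := hw ▸ hexp w

/-- A substitute for Jensen's formula: the quotient is 1 at the origin, so `c = 2` gives `2 ^ card ≤
exp (3 R)`, and `log 2 > 3 / 5`. -/
theorem card_zeros_le (hf : Differentiable ℂ f) (h0 : f 0 = 1)
    (hexp : ∀ z, ‖f z‖ ≤ Real.exp ‖z‖) (hz : EnumeratesZeros f ζ) {S : Finset ℕ} {R : ℝ}
    (hR : 0 < R) (hS : ∀ k ∈ S, ‖ζ k‖ ≤ R) : (S.card : ℝ) ≤ 5 * R := by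
  obtain ⟨g, hg, hfg, -⟩ := hz.exists_eq_prod_mul hf (by simp [h0]) S
  have h1 := norm_quotient_le h0 hexp hz hR hS two_pos hg hfg (z := 0) (by simp; positivity)
  have hg0 : g 0 = 1 := by simpa [h0] using (hfg 0).symm
  rw [hg0, norm_one, mul_one] at h1
  have h2 := Real.log_le_log (by positivity) h1
  rw [Real.log_exp, Real.log_pow] at h2
  have h3 := Real.log_two_gt_d9
  have h4 : (S.card : ℝ) * (3 / 5) ≤ S.card * Real.log 2 := by gcongr; linarith
  linarith

theorem one_fifth_le_norm_zero (hf : Differentiable ℂ f) (h0 : f 0 = 1)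
    (hexp : ∀ z, ‖f z‖ ≤ Real.exp ‖z‖) (hz : EnumeratesZeros f ζ) (k : ℕ) : 1 / 5 ≤ ‖ζ k‖ := by
  have := card_zeros_le hf h0 hexp hz (S := {k}) (R := ‖ζ k‖)
    (norm_pos_iff.2 (hz.ne_zero (by simp [h0]) k)) (by simp)
  simp at this
  linarith

/-- Dyadic shells: at most `5 * 2 ^ m` zeros have shell index `m`, each contributing at most `25 / 4
^ m`, so the shells form a convergent geometric series. -/
theorem summable_inv_norm_zero_sq (hf : Differentiable ℂ f) (h0 : f 0 = 1)
    (hexp : ∀ z, ‖f z‖ ≤ Real.exp ‖z‖) (hz : EnumeratesZeros f ζ) :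
    Summable fun k => ‖(ζ k)⁻¹‖ ^ 2 := by
  have hex : ∀ k, ∃ m : ℕ, ‖ζ k‖ ≤ 2 ^ m := fun k =>
    (pow_unbounded_of_one_lt ‖ζ k‖ one_lt_two).imp fun _ h => h.le
  classical
  let d : ℕ → ℕ := fun k => Nat.find (hex k)
  have hd : ∀ k, ‖ζ k‖ ≤ 2 ^ d k := fun k => Nat.find_spec (hex k)
  have hterm : ∀ k, ‖(ζ k)⁻¹‖ ^ 2 ≤ 25 * (1 / 4) ^ d k := by
    intro k
    have h5 := one_fifth_le_norm_zero hf h0 hexp hz k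
    -- Minimality of `d k` gives the better factor 1/2 except in the innermost shell, where the
    -- universal bound 1/5 is used.
    have h6 : (1 / 5 : ℝ) * 2 ^ d k ≤ ‖ζ k‖ := by
      rcases Nat.eq_zero_or_pos (d k) with hk | hk
      · rw [hk]; linarith
      · have h7 := Nat.find_min (hex k) (Nat.sub_lt hk one_pos)
        rw [not_le] at h7
        have h8 : (2 : ℝ) ^ d k = 2 ^ (d k - 1) * 2 := by
          rw [← pow_succ, Nat.sub_add_cancel hk]
        have h9 : (2 : ℝ) ^ (d k - 1) < ‖ζ k‖ := h7
        have : (0 : ℝ) < 2 ^ (d k - 1) := by positivity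
        linarith
    rw [norm_inv]
    calc (‖ζ k‖⁻¹) ^ 2 ≤ ((1 / 5 * 2 ^ d k)⁻¹) ^ 2 := by gcongr
      _ = 25 * (1 / 4) ^ d k := by
        rw [mul_inv, mul_pow, ← inv_pow, ← pow_mul, mul_comm (d k) 2, pow_mul]
        norm_num
  refine Summable.of_nonneg_of_le (fun k => by positivity) hterm ?_
  refine summable_of_sum_le (c := 125 * 2) (fun k => by positivity) fun T => ?_
  rw [Finset.sum_comp (fun m : ℕ => (25 * (1 / 4) ^ m : ℝ)) d]
  calc ∑ m ∈ T.image d, (T.filter fun k => d k = m).card • (25 * (1 / 4) ^ m : ℝ)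
      ≤ ∑ m ∈ T.image d, 125 * (1 / 2 : ℝ) ^ m := by
        refine Finset.sum_le_sum fun m _ => ?_
        have hc := card_zeros_le hf h0 hexp hz (S := T.filter fun k => d k = m) (R := 2 ^ m)
          (by positivity) (fun k hk => by simpa [(Finset.mem_filter.1 hk).2] using hd k)
        rw [nsmul_eq_mul]
        calc _ ≤ 5 * 2 ^ m * (25 * (1 / 4) ^ m : ℝ) := by gcongr
          _ = 125 * ((2 * (1 / 4)) ^ m) := by rw [mul_pow]; ring
          _ = _ := by norm_num
    _ = 125 * ∑ m ∈ T.image d, (1 / 2 : ℝ) ^ m := by rw [Finset.mul_sum]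
    _ ≤ 125 * 2 := by
        gcongr
        exact (summable_geometric_two.sum_le_tsum _ fun _ _ => by positivity).trans_eq
          tsum_geometric_two

end Hadamard

/-! ### Hadamard factorization -/

/-- A zero-free holomorphic function on a disc has a holomorphic logarithm. -/
theorem exists_log_of_ne_zero_on_ball {g : ℂ → ℂ} (hg : Differentiable ℂ g) {R : ℝ} (hR : 0 < R)
    (hne : ∀ z, ‖z‖ < R → g z ≠ 0) (h0 : g 0 = 1) :
    ∃ h : ℂ → ℂ, DifferentiableOn ℂ h (Metric.ball 0 R) ∧ h 0 = 0 ∧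
      HasDerivAt h (deriv g 0) 0 ∧ ∀ z, ‖z‖ < R → Complex.exp (h z) = g z := by
  have hq : DifferentiableOn ℂ (fun z => deriv g z / g z) (Metric.ball 0 R) :=
    hg.deriv.differentiableOn.div hg.differentiableOn fun z hz => hne z (by simpa using hz)
  obtain ⟨F, hF⟩ := hq.isExactOn_ball
  have hmem : (0 : ℂ) ∈ Metric.ball (0 : ℂ) R := by simpa using hR
  refine ⟨fun z => F z - F 0, fun z hz => ((hF z hz).differentiableAt.sub_const
    _).differentiableWithinAt, sub_self _, by simpa [h0] using (hF 0 hmem).sub_const (F 0),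
    fun z hz => ?_⟩
  -- `F` is a primitive of `g' / g`, so `g * exp (-(F - F 0))` has zero derivative and keeps its
  -- value 1 from the origin.
  have hd : ∀ w ∈ Metric.ball (0 : ℂ) R,
      HasDerivAt (fun z => g z * Complex.exp (-(F z - F 0))) 0 w := by
    intro w hw
    have h1 := (hg w).hasDerivAt.mul ((hF w hw).sub_const (F 0)).neg.cexp
    convert! h1 using 1
    have := hne w (by simpa using hw)
    field_simp
    ring
  have hc := (convex_ball (0 : ℂ) R).is_const_of_fderivWithin_eq_zero (𝕜 := ℂ)
    (fun w hw => (hd w hw).differentiableAt.differentiableWithinAt)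
    (fun w hw => by
      rw [fderivWithin_of_isOpen Metric.isOpen_ball hw, (hd w hw).hasFDerivAt.fderiv]
      ext; simp) hmem (show z ∈ Metric.ball 0 R by simpa using hz)
  simp only [sub_self, neg_zero, Complex.exp_zero, h0, mul_one] at hc
  rw [Complex.exp_neg, ← div_eq_mul_inv, eq_div_iff (Complex.exp_ne_zero _), one_mul] at hc
  exact hc

/-- Second order Taylor estimate for a holomorphic function with real part bounded above. -/
theorem norm_sub_deriv_mul_le {h : ℂ → ℂ} {R M : ℝ} (hR : 0 < R) (hM : 0 < M)
    (hh : DifferentiableOn ℂ h (Metric.ball 0 R)) (h0 : h 0 = 0)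
    (hre : ∀ z, ‖z‖ < R → (h z).re ≤ M) {d : ℂ} (hd : HasDerivAt h d 0) {t : ℂ}
    (ht : ‖t‖ < R / 2) : ‖h t - d * t‖ ≤ 16 * M * (‖t‖ / R) ^ 2 := by
  have hball : Metric.ball (0 : ℂ) (R / 2) ⊆ Metric.ball 0 R :=
    Metric.ball_subset_ball (by linarith)
  -- Borel–Carathéodory: the bound `2 M ‖z‖ / (R - ‖z‖)` is at most `2 M` on the half disc.
  have hb : ∀ z, ‖z‖ < R / 2 → ‖h z‖ ≤ 2 * M := by
    intro z hz
    refine (Complex.borelCaratheodory_zero hM hh (fun w hw => hre w (by simpa using hw)) hR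
      (hball (by simpa using hz)) h0).trans ?_
    rw [div_le_iff₀ (by linarith)]
    gcongr
    linarith
  have hdn : ‖d‖ ≤ 2 * M / (R / 2) := by
    rw [← hd.deriv]
    refine Complex.norm_deriv_le_div_of_mapsTo_ball (hh.mono hball) (fun z hz => ?_)
      (by positivity)
    rw [h0]
    simpa using hb z (by simpa using hz)
  -- Higher-order Schwarz lemma: `h z - d z` is `o(z)` and at most `4 M` on the half disc, hence at
  -- most `4 M (2 ‖t‖ / R) ^ 2`.
  have h2 := Complex.dist_le_mul_div_pow_of_mapsTo_ball_of_isLittleO (f := fun z => h z - d * z)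
    (c := 0) (z := t) (R₁ := R / 2) (R₂ := 4 * M) (n := 1)
    ((hh.mono hball).sub (by fun_prop)) (fun z hz => ?_) ?_ (by simpa using ht)
  · simp only [h0, mul_zero, sub_zero, dist_zero_right] at h2
    rw [show ‖t‖ / (R / 2) = 2 * (‖t‖ / R) by field_simp] at h2
    linarith
  · simp only [h0, mul_zero, sub_zero, mem_closedBall_zero_iff]
    have hz' : ‖z‖ < R / 2 := by simpa using hz
    calc ‖h z - d * z‖ ≤ ‖h z‖ + ‖d * z‖ := norm_sub_le _ _
      _ ≤ 2 * M + 2 * M / (R / 2) * (R / 2) := by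
        rw [norm_mul]
        gcongr
        exact hb z hz'
      _ = 4 * M := by field_simp; ring
  · have := hd.isLittleO
    simp only [h0, mul_zero, sub_zero, pow_one, smul_eq_mul] at this ⊢
    simpa [mul_comm] using this.norm_right

/-- The linear terms cancel; this is why square summability of the inverse zeros suffices for the
product. -/
theorem Complex.norm_one_sub_mul_exp_sub_one_le {x : ℂ} (hx : ‖x‖ ≤ 1) :
    ‖(1 - x) * Complex.exp x - 1‖ ≤ 3 * ‖x‖ ^ 2 := by
  have h1 := Complex.norm_exp_sub_one_sub_id_le hx
  have h2 : (1 - x) * Complex.exp x - 1 = (1 - x) * (Complex.exp x - 1 - x) - x ^ 2 := by ring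
  rw [h2]
  calc _ ≤ ‖1 - x‖ * ‖Complex.exp x - 1 - x‖ + ‖x‖ ^ 2 := by
        rw [← norm_mul, ← norm_pow]; exact norm_sub_le _ _
    _ ≤ 2 * ‖x‖ ^ 2 + ‖x‖ ^ 2 := by
        gcongr
        calc ‖1 - x‖ ≤ ‖(1 : ℂ)‖ + ‖x‖ := norm_sub_le _ _
          _ ≤ 2 := by rw [norm_one]; linarith
    _ = _ := by ring

theorem multipliable_weierstrass_factor {c : ℕ → ℂ} (hc : Summable fun k => ‖c k‖ ^ 2) (t : ℂ) :
    Multipliable fun k => (1 - t * c k) * Complex.exp (t * c k) := by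
  have h1 : Summable fun k => ‖t * c k‖ ^ 2 := by
    simp only [norm_mul, mul_pow]
    exact hc.mul_left _
  have h2 : Summable fun k => ‖(1 - t * c k) * Complex.exp (t * c k) - 1‖ := by
    refine summable_of_isBigO_nat h1 (Asymptotics.IsBigO.of_bound 3 ?_)
    have h3 := h1.tendsto_atTop_zero
    filter_upwards [h3.eventually (gt_mem_nhds one_pos)] with k hk
    have hk' : ‖t * c k‖ ≤ 1 := by
      by_contra! hlt
      nlinarith
    simpa using Complex.norm_one_sub_mul_exp_sub_one_le hk'
  simpa using multipliable_one_add_of_summable h2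

/-- **Hadamard factorization** for entire functions of exponential type. -/
theorem EnumeratesZeros.hasProd {f : ℂ → ℂ} {ζ : ℕ → ℂ} (hz : EnumeratesZeros f ζ)
    (hf : Differentiable ℂ f) (h0 : f 0 = 1) (hexp : ∀ z, ‖f z‖ ≤ Real.exp ‖z‖) (t : ℂ) :
    HasProd (fun k => (1 - t * (ζ k)⁻¹) * Complex.exp (t * (ζ k)⁻¹))
      (f t * Complex.exp (-(deriv f 0 * t))) := by
  have hP := (multipliable_weierstrass_factor
    (summable_inv_norm_zero_sq hf h0 hexp hz) t).hasProd
  have hne := hz.ne_zero (f := f) (by simp [h0])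
  have hfin : ∀ n : ℕ, {k | ‖ζ k‖ ≤ n}.Finite := by
    intro n
    by_contra hinf
    -- One more zero than `card_zeros_le` allows in radius `n + 1`, a radius that is positive even
    -- for `n = 0`.
    obtain ⟨T, hT, hcard⟩ := Set.Infinite.exists_subset_card_eq hinf (5 * (n + 1) + 1)
    have := card_zeros_le hf h0 hexp hz (S := T) (R := n + 1) (by positivity)
      (fun k hk => (show ‖ζ k‖ ≤ n from hT hk).trans (by linarith))
    rw [hcard] at this
    push_cast at this
    linarith
  let S : ℕ → Finset ℕ := fun n => (hfin n).toFinset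
  have hS : Tendsto S atTop atTop := by
    refine tendsto_atTop_finset_of_monotone (fun m n hmn k hk => ?_) fun k => ?_
    · simp only [S, Set.Finite.mem_toFinset, Set.mem_ofPred_eq] at hk ⊢
      exact hk.trans (by exact_mod_cast hmn)
    · obtain ⟨n, hn⟩ := exists_nat_ge ‖ζ k‖
      exact ⟨n, by simpa [S] using hn⟩
  have hlim := hP.comp hS
  -- Removing the zeros in the closed disc of radius `n` leaves `g = exp h` on the open disc, with
  -- `Re h ≤ 2 n`. The error `u` is the second-order Taylor remainder of `h`, bounded by `16 (2 n)
  -- (‖t‖ / n) ^ 2`.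
  have key : ∀ n : ℕ, 2 * ‖t‖ < n → ∃ u : ℂ, ‖u‖ ≤ 32 * ‖t‖ ^ 2 / n ∧
      f t * Complex.exp (-(deriv f 0 * t)) =
        (∏ k ∈ S n, (1 - t * (ζ k)⁻¹) * Complex.exp (t * (ζ k)⁻¹)) * Complex.exp u := by
    intro n hn
    have hn0 : (0 : ℝ) < n := (by positivity : (0 : ℝ) ≤ 2 * ‖t‖).trans_lt hn
    have hSn : ∀ k, k ∈ S n ↔ ‖ζ k‖ ≤ n := by simp [S]
    obtain ⟨g, hg, hfg, hord⟩ := hz.exists_eq_prod_mul hf (by simp [h0]) (S n)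
    have hg0 : g 0 = 1 := by simpa [h0] using (hfg 0).symm
    have hgne : ∀ z, ‖z‖ < n → g z ≠ 0 := by
      intro z hz'
      have h1 := hord z
      have h2 : {k : ℕ | k ∉ S n ∧ ζ k = z} = ∅ := by
        ext k
        simp only [hSn, Set.mem_ofPred_eq, Set.mem_empty_iff_false, iff_false, not_and]
        rintro h3 rfl
        exact h3 hz'.le
      rw [h2, Set.encard_empty, eq_comm, analyticOrderAt_eq_zero] at h1
      exact h1.resolve_left (not_not.2 (hg.analyticAt z))
    obtain ⟨h, hh, hh0, hhd, hhexp⟩ := exists_log_of_ne_zero_on_ball hg hn0 hgne hg0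
    have hre : ∀ z, ‖z‖ < n → (h z).re ≤ 2 * n := by
      intro z hz'
      have h1 := norm_quotient_le h0 hexp hz hn0 (fun k hk => (hSn k).1 hk) one_pos hg hfg
        (z := z) (by linarith)
      rw [one_pow, one_mul, ← hhexp z hz', Complex.norm_exp, Real.exp_le_exp] at h1
      linarith
    refine ⟨h t - deriv g 0 * t, ?_, ?_⟩
    · refine (norm_sub_deriv_mul_le hn0 (by positivity) hh hh0 hre hhd (t := t)
        (by linarith)).trans_eq ?_
      field_simp
      ring
    -- The logarithmic derivative at 0 splits `exp (g'(0) t)` into the convergence factors `exp (t /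
    -- ζ k)` and `exp (f'(0) t)`.
    · have hder : deriv f 0 = deriv g 0 - ∑ k ∈ S n, (ζ k)⁻¹ := by
        have h1 : HasDerivAt (fun z => ∏ k ∈ S n, (1 - z / ζ k)) (-∑ k ∈ S n, (ζ k)⁻¹) 0 := by
          have h2 := HasDerivAt.fun_finsetProd (u := S n) (f := fun k (z : ℂ) => 1 - z / ζ k)
            (f' := fun k => -(ζ k)⁻¹) (x := 0)
            (fun k _ => by simpa using ((hasDerivAt_id (0 : ℂ)).div_const (ζ k)).const_sub 1)
          simpa using h2
        have h3 := h1.mul (hg 0).hasDerivAt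
        have h4 : f = (fun z => ∏ k ∈ S n, (1 - z / ζ k)) * g := funext hfg
        rw [h4, h3.deriv, hg0]
        simp
        ring
      have hgt : g t = Complex.exp (h t) := (hhexp t (by linarith [norm_nonneg t])).symm
      rw [hfg t, hgt, Finset.prod_mul_distrib, ← Complex.exp_sum, ← Finset.mul_sum, hder]
      simp only [div_eq_mul_inv, mul_assoc, ← Complex.exp_add]
      congr 2
      ring
  choose! u hu hfu using key
  have hev : ∀ᶠ n : ℕ in atTop, 2 * ‖t‖ < n := tendsto_natCast_atTop_atTop.eventually_gt_atTop _
  have hu0 : Tendsto u atTop (𝓝 0) := by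
    refine squeeze_zero_norm' (hev.mono fun n hn => hu n hn) ?_
    exact tendsto_const_nhds.div_atTop tendsto_natCast_atTop_atTop
  have h1 := hlim.mul ((Complex.continuous_exp.tendsto 0).comp hu0)
  rw [Complex.exp_zero, mul_one] at h1
  have h2 := h1.congr' (hev.mono fun n hn => (hfu n hn).symm)
  rw [tendsto_nhds_unique tendsto_const_nhds h2]
  exact hP

/-! ### Analytic properties of the Kummer function -/

/-- The Taylor coefficients of the Kummer function. -/
noncomputable def kummerCoeff (a b : ℝ) (k : ℕ) : ℂ :=
  (ascPochhammer ℂ k).eval (a : ℂ) / (ascPochhammer ℂ k).eval ((a : ℂ) + b) / (k.factorial : ℂ)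

theorem ascPochhammer_eval_ofReal (k : ℕ) (x : ℝ) :
    (ascPochhammer ℂ k).eval (x : ℂ) = ((ascPochhammer ℝ k).eval x : ℝ) := by
  have := (ascPochhammer ℝ k).eval_map_apply (f := Complex.ofRealHom) x
  rwa [ascPochhammer_map] at this

theorem ascPochhammer_eval_mono {x y : ℝ} (hx : 0 < x) (hxy : x ≤ y) (k : ℕ) :
    (ascPochhammer ℝ k).eval x ≤ (ascPochhammer ℝ k).eval y := by
  induction k with
  | zero => simp
  | succ k ih =>
    rw [ascPochhammer_succ_eval, ascPochhammer_succ_eval]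
    have := ascPochhammer_pos k y (hx.trans_le hxy)
    gcongr

section

variable {a b : ℝ}

theorem norm_kummerCoeff_le (ha : 0 < a) (hb : 0 < b) (k : ℕ) :
    ‖kummerCoeff a b k‖ ≤ 1 / (k.factorial : ℝ) := by
  have hab : (a : ℂ) + b = ((a + b : ℝ) : ℂ) := by push_cast; rfl
  rw [kummerCoeff, hab, ascPochhammer_eval_ofReal, ascPochhammer_eval_ofReal, norm_div, norm_div,
    Complex.norm_natCast, Complex.norm_real, Complex.norm_real,
    Real.norm_of_nonneg (ascPochhammer_pos k a ha).le,
    Real.norm_of_nonneg (ascPochhammer_pos k (a + b) (by positivity)).le]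
  gcongr
  rw [div_le_one (ascPochhammer_pos k (a + b) (by positivity))]
  exact ascPochhammer_eval_mono ha (by linarith) k

theorem summable_norm_kummerCoeff_mul_pow (ha : 0 < a) (hb : 0 < b) (z : ℂ) :
    Summable fun k => ‖kummerCoeff a b k * z ^ k‖ := by
  refine Summable.of_nonneg_of_le (fun k => norm_nonneg _) (fun k => ?_)
    (Real.summable_pow_div_factorial ‖z‖)
  rw [norm_mul, norm_pow, div_eq_mul_one_div, mul_comm]
  gcongr
  exact norm_kummerCoeff_le ha hb k

theorem hasSum_kummerPhi (ha : 0 < a) (hb : 0 < b) (z : ℂ) :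
    HasSum (fun k => kummerCoeff a b k * z ^ k) (kummerPhi a b z) := by
  have h : kummerPhi a b z = ∑' k, kummerCoeff a b k * z ^ k := by
    rw [kummerPhi_eq_tsum (by positivity)]
    refine tsum_congr fun k => ?_
    rw [kummerCoeff]
    ring
  rw [h]
  exact (summable_norm_kummerCoeff_mul_pow ha hb z).of_norm.hasSum

theorem norm_kummerPhi_le (ha : 0 < a) (hb : 0 < b) (z : ℂ) :
    ‖kummerPhi a b z‖ ≤ Real.exp ‖z‖ := by
  rw [← (hasSum_kummerPhi ha hb z).tsum_eq, Real.exp_eq_exp_ℝ, NormedSpace.exp_eq_tsum_div]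
  refine tsum_of_norm_bounded (Real.summable_pow_div_factorial ‖z‖).hasSum fun k => ?_
  rw [norm_mul, norm_pow, div_eq_mul_one_div, mul_comm]
  gcongr
  exact norm_kummerCoeff_le ha hb k

theorem kummerPhi_zero (ha : 0 < a) (hb : 0 < b) : kummerPhi a b 0 = 1 := by
  rw [← (hasSum_kummerPhi ha hb 0).tsum_eq, tsum_eq_single 0 fun k hk => by simp [hk]]
  simp [kummerCoeff]

theorem hasFPowerSeriesOnBall_kummerPhi (a b : ℝ) :
    HasFPowerSeriesOnBall (kummerPhi a b) (Complex.Gamma ((a : ℂ) + b) •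
      Complex.regularizedHGFunSeries {(a : ℂ)} {(a : ℂ) + b}) 0 ⊤ := by
  have hr := Complex.radius_regularizedHGFunSeries_eq_top (a := {(a : ℂ)}) (b := {(a : ℂ) + b})
    (by simp)
  have := (Complex.regularizedHGFunSeries {(a : ℂ)} {(a : ℂ) + b}).hasFPowerSeriesOnBall
    (by simp [hr])
  rw [hr] at this
  exact this.const_smul (c := Complex.Gamma ((a : ℂ) + b))

theorem differentiable_kummerPhi (a b : ℝ) : Differentiable ℂ (kummerPhi a b) := by
  have := (hasFPowerSeriesOnBall_kummerPhi a b).differentiableOn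
  rwa [Metric.eball_top, differentiableOn_univ] at this

/-- This is the exponent in the Hadamard factorization, matching the constant in `zPartialSum`. -/
theorem deriv_kummerPhi_zero (ha : 0 < a) (hb : 0 < b) :
    deriv (kummerPhi a b) 0 = (a : ℂ) / ((a : ℂ) + b) := by
  have hne : (a : ℂ) + b ≠ 0 := by
    have : a + b ≠ 0 := by positivity
    exact_mod_cast this
  have hG : Complex.Gamma ((a : ℂ) + b) ≠ 0 :=
    Complex.Gamma_ne_zero_of_re_pos (by simp; positivity)
  rw [(hasFPowerSeriesOnBall_kummerPhi a b).hasFPowerSeriesAt.deriv]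
  simp [Complex.regularizedHGFunSeries, Complex.regularizedHGFunCoeff,
    Complex.Gamma_add_one _ hne]
  field_simp

end

/-! ### Exponential law: transforms and mean -/

section ExponentialLaw

variable {E : Type*} [NormedAddCommGroup E] [NormedSpace ℝ E]

theorem exponentialPDF_toReal_smul (F : ℝ → E) :
    (fun x => (exponentialPDF 1 x).toReal • F x) =
      (Set.Ici (0 : ℝ)).indicator fun x => Real.exp (-x) • F x := by
  ext x
  rw [exponentialPDF_eq]
  by_cases hx : 0 ≤ x
  · simp [hx, Real.exp_nonneg]
  · simp [hx]

theorem integral_expMeasure_one (F : ℝ → E) :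
    ∫ x, F x ∂(expMeasure 1) = ∫ x in Set.Ioi 0, Real.exp (-x) • F x := by
  have h : expMeasure 1 = volume.withDensity (exponentialPDF 1) := rfl
  have hm : Measurable (exponentialPDF 1) := (measurable_exponentialPDFReal 1).ennreal_ofReal
  rw [h, integral_withDensity_eq_integral_toReal_smul hm
    (ae_of_all _ fun x => ENNReal.ofReal_lt_top), exponentialPDF_toReal_smul,
    integral_indicator measurableSet_Ici, integral_Ici_eq_integral_Ioi]

theorem integrable_expMeasure_one_iff (F : ℝ → E) :
    Integrable F (expMeasure 1) ↔
      IntegrableOn (fun x => Real.exp (-x) • F x) (Set.Ioi 0) := by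
  have h : expMeasure 1 = volume.withDensity (exponentialPDF 1) := rfl
  have hm : Measurable (exponentialPDF 1) := (measurable_exponentialPDFReal 1).ennreal_ofReal
  rw [h, integrable_withDensity_iff_integrable_smul' hm
    (ae_of_all _ fun x => ENNReal.ofReal_lt_top), exponentialPDF_toReal_smul,
    integrable_indicator_iff measurableSet_Ici, integrableOn_Ici_iff_integrableOn_Ioi]

theorem exp_neg_smul_cexp (s : ℂ) :
    (fun x : ℝ => Real.exp (-x) • Complex.exp (s * x)) =
      fun x : ℝ => Complex.exp ((s - 1) * x) := by
  ext x
  rw [Complex.real_smul, Complex.ofReal_exp, ← Complex.exp_add]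
  push_cast
  ring_nf

theorem integrable_cexp_mul_expMeasure {s : ℂ} (hs : s.re < 1) :
    Integrable (fun x : ℝ => Complex.exp (s * x)) (expMeasure 1) := by
  rw [integrable_expMeasure_one_iff, exp_neg_smul_cexp]
  exact integrableOn_exp_mul_complex_Ioi (by simpa using hs) 0

theorem integral_cexp_mul_expMeasure {s : ℂ} (hs : s.re < 1) :
    ∫ x : ℝ, Complex.exp (s * x) ∂(expMeasure 1) = (1 - s)⁻¹ := by
  rw [integral_expMeasure_one, exp_neg_smul_cexp,
    integral_exp_mul_complex_Ioi (by simpa using hs)]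
  simp only [Complex.ofReal_zero, mul_zero, Complex.exp_zero]
  rw [neg_div, one_div, ← inv_neg, neg_sub]

theorem integral_id_expMeasure_one : ∫ x : ℝ, x ∂(expMeasure 1) = 1 := by
  rw [integral_expMeasure_one]
  have h := Real.integral_rpow_mul_exp_neg_mul_Ioi (a := 2) (r := 1) two_pos one_pos
  norm_num at h
  simpa [mul_comm] using h

variable {Ω : Type*} [MeasurableSpace Ω] {μ : Measure Ω} {X : Ω → ℝ}

theorem integrable_cexp_mul_sub_one (hX : HasLaw X (expMeasure 1) μ) {s : ℂ} (hs : s.re < 1) :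
    Integrable (fun ω => Complex.exp (s * (X ω - 1))) μ := by
  have h := integrable_cexp_mul_expMeasure hs
  rw [← hX.map_eq] at h
  have h2 := (h.comp_aemeasurable hX.aemeasurable).const_mul (Complex.exp (-s))
  refine h2.congr (ae_of_all _ fun ω => ?_)
  simp only [Function.comp, ← Complex.exp_add]
  ring_nf

theorem integral_cexp_mul_sub_one (hX : HasLaw X (expMeasure 1) μ) {s : ℂ} (hs : s.re < 1) :
    ∫ ω, Complex.exp (s * (X ω - 1)) ∂μ = Complex.exp (-s) * (1 - s)⁻¹ := by
  rw [← integral_cexp_mul_expMeasure hs, ← hX.integral_comp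
    (integrable_cexp_mul_expMeasure hs).aestronglyMeasurable, ← integral_const_mul]
  congr with ω
  simp only [Function.comp, ← Complex.exp_add]
  ring_nf

theorem ofReal_exp_mul_sub_one {Ω : Type*} (X : Ω → ℝ) (r : ℝ) :
    (fun ω => Complex.exp (r * (X ω - 1))) = fun ω => ((Real.exp (r * (X ω - 1)) : ℝ) : ℂ) := by
  ext ω
  push_cast
  rfl

theorem integrable_exp_mul_sub_one (hX : HasLaw X (expMeasure 1) μ) {r : ℝ} (hr : r < 1) :
    Integrable (fun ω => Real.exp (r * (X ω - 1))) μ := by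
  have h := integrable_cexp_mul_sub_one hX (s := r) (by simpa using hr)
  rw [ofReal_exp_mul_sub_one] at h
  exact h.re.congr (ae_of_all _ fun ω => Complex.ofReal_re _)

theorem integral_exp_mul_sub_one (hX : HasLaw X (expMeasure 1) μ) {r : ℝ} (hr : r < 1) :
    ∫ ω, Real.exp (r * (X ω - 1)) ∂μ = Real.exp (-r) * (1 - r)⁻¹ := by
  have h := integral_cexp_mul_sub_one hX (s := r) (by simpa using hr)
  rw [ofReal_exp_mul_sub_one, integral_complex_ofReal] at h
  exact_mod_cast h

theorem integral_sub_one [IsProbabilityMeasure μ] (hX : HasLaw X (expMeasure 1) μ)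
    (hi : Integrable X μ) : ∫ ω, (X ω - 1) ∂μ = 0 := by
  rw [integral_sub hi (integrable_const _), hX.integral_eq, integral_id_expMeasure_one]
  simp

/-- A nonintegrable function has Bochner integral 0 by convention, whereas the identity has integral
1. -/
theorem integrable_of_hasLaw_expMeasure [IsProbabilityMeasure μ]
    (hX : HasLaw X (expMeasure 1) μ) : Integrable X μ := by
  have h0 : Integrable (fun x : ℝ => x) (expMeasure 1) := by
    by_contra h
    have := integral_id_expMeasure_one
    rw [integral_undef h] at this
    exact zero_ne_one this
  rw [← hX.map_eq] at h0
  exact h0.comp_aemeasurable hX.aemeasurable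

/-- In `-log (1 - r) = r + O(r²)` the linear term is cancelled by centring; the remainder is at most
`r² / (1 - |r|)`. -/
theorem exp_neg_mul_inv_le {r : ℝ} (hr : |r| ≤ 1 / 2) :
    Real.exp (-r) * (1 - r)⁻¹ ≤ Real.exp (2 * r ^ 2) := by
  have h1 := Real.abs_log_sub_add_sum_range_le (x := r) (by linarith) 1
  have hr' := abs_le.1 hr
  have hpos : 0 < 1 - r := by linarith
  simp only [Finset.range_one, Finset.sum_singleton, zero_add, pow_one, Nat.cast_zero,
    div_one, sq_abs, one_add_one_eq_two] at h1
  have h2 : r ^ 2 / (1 - |r|) ≤ 2 * r ^ 2 := by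
    rw [div_le_iff₀ (by linarith)]
    nlinarith [sq_nonneg r]
  have h3 := (abs_le.1 (h1.trans h2)).1
  rw [← Real.exp_log (inv_pos.2 hpos), ← Real.exp_add, Real.log_inv]
  gcongr
  linarith

end ExponentialLaw

/-! ### Real series of centred exponential variables -/

section ExponentialSeries

variable {Ω : Type*} [MeasurableSpace Ω] {μ : Measure Ω} [IsProbabilityMeasure μ]
  {Γ : ℕ → Ω → ℝ}

theorem integrable_exp_sum (hm : ∀ k, Measurable (Γ k))
    (hΓ : ∀ k, HasLaw (Γ k) (expMeasure 1) μ) (hind : iIndepFun Γ μ) {r : ℕ → ℝ}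
    (hr : ∀ k, |r k| ≤ 1 / 2) (N : ℕ) :
    Integrable (fun ω => Real.exp (∑ k ∈ Finset.range N, r k * (Γ k ω - 1))) μ := by
  have h := (hind.comp (fun k x => r k * (x - 1)) fun k => by fun_prop).integrable_exp_mul_sum
    (t := 1) (s := Finset.range N) (fun k => by fun_prop) fun k _ => by
      simpa using integrable_exp_mul_sub_one (hΓ k) (r := r k) (by linarith [le_abs_self (r k), hr k])
  simpa using h

omit [IsProbabilityMeasure μ] in
theorem integral_exp_sum_le (hm : ∀ k, Measurable (Γ k))
    (hΓ : ∀ k, HasLaw (Γ k) (expMeasure 1) μ) (hind : iIndepFun Γ μ) {r : ℕ → ℝ}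
    (hr : ∀ k, |r k| ≤ 1 / 2) (hs : Summable fun k => r k ^ 2) (N : ℕ) :
    ∫ ω, Real.exp (∑ k ∈ Finset.range N, r k * (Γ k ω - 1)) ∂μ ≤
      Real.exp (2 * ∑' k, r k ^ 2) := by
  have h := (hind.comp (fun k x => r k * (x - 1)) fun k => by fun_prop).mgf_sum₀
    (t := 1) (fun k => by fun_prop) (Finset.range N)
  simp only [mgf, one_mul, Finset.sum_apply, Function.comp] at h
  rw [h]
  calc _ ≤ ∏ k ∈ Finset.range N, Real.exp (2 * r k ^ 2) := by
        refine Finset.prod_le_prod (fun k _ => integral_nonneg fun ω => (Real.exp_pos _).le)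
          fun k _ => ?_
        rw [integral_exp_mul_sub_one (hΓ k) (by linarith [le_abs_self (r k), hr k])]
        exact exp_neg_mul_inv_le (hr k)
    _ = Real.exp (2 * ∑ k ∈ Finset.range N, r k ^ 2) := by
        rw [← Real.exp_sum, Finset.mul_sum]
    _ ≤ _ := by
        gcongr
        exact hs.sum_le_tsum _ fun _ _ => by positivity

omit [IsProbabilityMeasure μ] in
theorem integral_cexp_sum (hm : ∀ k, Measurable (Γ k))
    (hΓ : ∀ k, HasLaw (Γ k) (expMeasure 1) μ) (hind : iIndepFun Γ μ) {s : ℕ → ℂ}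
    (hs : ∀ k, (s k).re < 1) (N : ℕ) :
    ∫ ω, Complex.exp (∑ k ∈ Finset.range N, s k * (Γ k ω - 1)) ∂μ =
      ∏ k ∈ Finset.range N, Complex.exp (-s k) * (1 - s k)⁻¹ := by
  have hfin : iIndepFun (fun k : Fin N => Γ k) μ := hind.precomp Fin.val_injective
  have h := hfin.integral_fun_prod_comp
    (f := fun (k : Fin N) (x : ℝ) => Complex.exp (s k * (x - 1))) (fun k => (hm k).aemeasurable)
    (fun k => by
      apply Measurable.aestronglyMeasurable
      fun_prop)
  rw [Finset.prod_range]
  simp_rw [Complex.exp_sum, Finset.prod_range]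
  rw [h]
  exact Finset.prod_congr rfl fun k _ => integral_cexp_mul_sub_one (hΓ k) (hs k)

/-- A square summable series of centred independent exponential variables converges. -/
theorem ae_exists_tendsto_sum_real_of_le (hm : ∀ k, Measurable (Γ k))
    (hΓ : ∀ k, HasLaw (Γ k) (expMeasure 1) μ) (hind : iIndepFun Γ μ) {r : ℕ → ℝ}
    (hr : ∀ k, |r k| ≤ 1 / 2) (hs : Summable fun k => r k ^ 2) :
    ∀ᵐ ω ∂μ, ∃ y : ℝ,
      Tendsto (fun N => ∑ k ∈ Finset.range N, r k * (Γ k ω - 1)) atTop (𝓝 y) := by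
  -- The sum runs through index `N` so that `M N` is adapted to the filtration generated by `Γ 0, …,
  -- Γ N`; the last line undoes the shift.
  let M : ℕ → Ω → ℝ := fun N ω => ∑ k ∈ Finset.range (N + 1), r k * (Γ k ω - 1)
  let ℱ := Filtration.natural Γ fun k => (hm k).stronglyMeasurable
  have hi : ∀ k, Integrable (fun ω => r k * (Γ k ω - 1)) μ := fun k =>
    ((integrable_of_hasLaw_expMeasure (hΓ k)).sub (integrable_const _)).const_mul _
  have hMi : ∀ N, Integrable (M N) μ := fun N => integrable_finsetSum _ fun k _ => hi k
  have hadapt : StronglyAdapted ℱ M := by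
    intro N
    refine Finset.stronglyMeasurable_fun_sum _ fun k hk => ?_
    have h1 : StronglyMeasurable[ℱ N] (Γ k) :=
      ((Filtration.stronglyAdapted_natural fun k => (hm k).stronglyMeasurable) k).mono
        (ℱ.mono (by simpa [Nat.lt_succ_iff] using hk))
    exact (h1.sub stronglyMeasurable_const).const_mul _
  have hmart : Martingale M ℱ μ := by
    refine martingale_of_condExp_sub_eq_zero_nat hadapt hMi fun N => ?_
    have h1 : M (N + 1) - M N = fun ω => r (N + 1) * (Γ (N + 1) ω - 1) := by
      ext ω
      simp [M, Finset.sum_range_succ _ (N + 1)]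
    -- The new variable is independent of the past, so the conditional mean of the increment is its
    -- mean, 0.
    have h2 := hind.indep_comap_natural_of_lt (fun k => (hm k).stronglyMeasurable)
      (Nat.lt_succ_self N)
    have h3 := condExp_indep_eq (f := fun ω => r (N + 1) * (Γ (N + 1) ω - 1))
      (hm (N + 1)).comap_le (ℱ.le N)
      (((comap_measurable (Γ (N + 1))).sub_const 1).const_mul (r (N + 1))).stronglyMeasurable h2
    rw [h1]
    refine h3.trans (ae_of_all _ fun ω => ?_)
    simp only [integral_const_mul, Pi.zero_apply]
    rw [integral_sub_one (hΓ _) (integrable_of_hasLaw_expMeasure (hΓ _)), mul_zero]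
  have hneg : ∀ N ω, -M N ω = ∑ k ∈ Finset.range (N + 1), (-r k) * (Γ k ω - 1) := by
    intro N ω
    simp [M, ← Finset.sum_neg_distrib]
  have hbdd : ∀ N, eLpNorm (M N) 1 μ ≤ (Real.toNNReal (2 * Real.exp (2 * ∑' k, r k ^ 2)) : ENNReal) := by
    intro N
    rw [eLpNorm_one_eq_lintegral_enorm, ← ofReal_integral_norm_eq_lintegral_enorm (hMi N)]
    refine ENNReal.ofReal_le_ofReal ?_
    have e1 := integrable_exp_sum hm hΓ hind hr (N + 1)
    have e2 := integrable_exp_sum hm hΓ hind (r := fun k => -r k) (by simpa using hr) (N + 1)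
    have b1 := integral_exp_sum_le hm hΓ hind hr hs (N + 1)
    have b2 := integral_exp_sum_le hm hΓ hind (r := fun k => -r k) (by simpa using hr)
      (by simpa using hs) (N + 1)
    simp only [neg_sq] at b2
    -- The L¹ bound follows from `|x| ≤ exp x + exp (-x)` and the uniform exponential moments of
    -- `±M`.
    calc ∫ ω, ‖M N ω‖ ∂μ ≤ ∫ ω, (Real.exp (∑ k ∈ Finset.range (N + 1), r k * (Γ k ω - 1)) +
          Real.exp (∑ k ∈ Finset.range (N + 1), (-r k) * (Γ k ω - 1))) ∂μ := by
          refine integral_mono (hMi N).norm (e1.add e2) fun ω => ?_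
          have h1 := Real.add_one_le_exp (M N ω)
          have h2 := Real.add_one_le_exp (-M N ω)
          have h3 := Real.exp_pos (M N ω)
          have h4 := Real.exp_pos (-M N ω)
          simp only [← hneg]
          change ‖M N ω‖ ≤ Real.exp (M N ω) + _
          rw [Real.norm_eq_abs, abs_le]
          constructor <;> linarith
      _ ≤ _ := by
          rw [integral_add e1 e2]
          linarith
  filter_upwards [hmart.submartingale.exists_ae_tendsto_of_bdd hbdd] with ω ⟨y, hy⟩
  exact ⟨y, (tendsto_add_atTop_iff_nat 1).1 hy⟩

/-- Convergence is invariant under scaling, so any bounded coefficients can be made small. -/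
theorem ae_exists_tendsto_sum_real (hm : ∀ k, Measurable (Γ k))
    (hΓ : ∀ k, HasLaw (Γ k) (expMeasure 1) μ) (hind : iIndepFun Γ μ) {r : ℕ → ℝ} {δ : ℝ}
    (hδ : 0 < δ) (hr : ∀ k, δ * |r k| ≤ 1 / 2) (hs : Summable fun k => r k ^ 2) :
    ∀ᵐ ω ∂μ, ∃ y : ℝ,
      Tendsto (fun N => ∑ k ∈ Finset.range N, r k * (Γ k ω - 1)) atTop (𝓝 y) := by
  filter_upwards [ae_exists_tendsto_sum_real_of_le hm hΓ hind (r := fun k => δ * r k)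
    (fun k => by rw [abs_mul, abs_of_pos hδ]; exact hr k)
    (by simpa only [mul_pow] using hs.mul_left (δ ^ 2))] with ω ⟨y, hy⟩
  refine ⟨δ⁻¹ * y, (hy.const_mul δ⁻¹).congr fun N => ?_⟩
  simp only [mul_assoc, ← Finset.mul_sum]
  field_simp

end ExponentialSeries

/-! ### Limits of integrals -/

section Convergence

variable {Ω : Type*} [MeasurableSpace Ω] {μ : Measure Ω} [IsProbabilityMeasure μ]

/-- Integrals converge along an almost everywhere convergent sequence bounded in `L²`. -/
theorem tendsto_integral_of_ae_tendsto_of_integral_sq_le {F : ℕ → Ω → ℂ} {f : Ω → ℂ} {K : ℝ}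
    (hF : ∀ n, AEStronglyMeasurable (F n) μ) (hF2 : ∀ n, Integrable (fun ω => ‖F n ω‖ ^ 2) μ)
    (hK : ∀ n, ∫ ω, ‖F n ω‖ ^ 2 ∂μ ≤ K) (hf : Integrable f μ)
    (hlim : ∀ᵐ ω ∂μ, Tendsto (fun n => F n ω) atTop (𝓝 (f ω))) :
    Tendsto (fun n => ∫ ω, F n ω ∂μ) atTop (𝓝 (∫ ω, f ω ∂μ)) := by
  have hK0 : 0 ≤ K := (integral_nonneg fun ω => by positivity).trans (hK 0)
  have hFi : ∀ n, Integrable (F n) μ := fun n =>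
    ((memLp_two_iff_integrable_sq_norm (hF n)).2 (hF2 n)).integrable one_le_two
  have hUI : UnifIntegrable F 1 μ := by
    refine unifIntegrable_of le_rfl ENNReal.one_ne_top hF fun ε hε => ?_
    -- Above the threshold `C`, `‖F‖ ≤ ‖F‖² / C`, so the tail integral is at most `K / C ≤ ε`; the
    -- `+ 1` keeps `C` positive when `K = 0`.
    have hC : 0 < (K + 1) / ε := by positivity
    refine ⟨Real.toNNReal ((K + 1) / ε), fun n => ?_⟩
    rw [eLpNorm_one_eq_lintegral_enorm]
    calc _ ≤ ∫⁻ ω, ENNReal.ofReal (‖F n ω‖ ^ 2 / ((K + 1) / ε)) ∂μ := by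
          refine lintegral_mono fun ω => ?_
          rw [← ofReal_norm]
          refine ENNReal.ofReal_le_ofReal ?_
          by_cases h : ω ∈ {x | Real.toNNReal ((K + 1) / ε) ≤ ‖F n x‖₊}
          · rw [Set.indicator_of_mem h]
            have h' : (K + 1) / ε ≤ ‖F n ω‖ := Real.toNNReal_le_iff_le_coe.1 h
            rw [le_div_iff₀ hC, sq]
            gcongr
          · rw [Set.indicator_of_notMem h, norm_zero]
            positivity
      _ = ENNReal.ofReal (∫ ω, ‖F n ω‖ ^ 2 / ((K + 1) / ε) ∂μ) :=
          (ofReal_integral_eq_lintegral_ofReal ((hF2 n).div_const _)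
            (ae_of_all _ fun ω => by positivity)).symm
      _ ≤ ENNReal.ofReal ε := by
          refine ENNReal.ofReal_le_ofReal ?_
          rw [integral_div, div_le_iff₀ hC, mul_div_cancel₀ _ hε.ne']
          linarith [hK n]
  exact tendsto_integral_of_L1' f hf.aestronglyMeasurable (Eventually.of_forall hFi)
    (tendsto_Lp_finite_of_tendsto_ae le_rfl ENNReal.one_ne_top hF
      (memLp_one_iff_integrable.2 hf) hUI hlim)

omit [IsProbabilityMeasure μ] in
/-- Fatou's lemma for nonnegative real functions. -/
theorem integrable_of_ae_tendsto_of_integral_le {F : ℕ → Ω → ℝ} {f : Ω → ℝ} {K : ℝ}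
    (hF : ∀ n, Integrable (F n) μ) (h0 : ∀ n ω, 0 ≤ F n ω) (hK : ∀ n, ∫ ω, F n ω ∂μ ≤ K)
    (hlim : ∀ᵐ ω ∂μ, Tendsto (fun n => F n ω) atTop (𝓝 (f ω))) : Integrable f μ := by
  refine ⟨aestronglyMeasurable_of_tendsto_ae atTop (fun n => (hF n).aestronglyMeasurable) hlim, ?_⟩
  have h1 : ∫⁻ ω, ‖f ω‖ₑ ∂μ = ∫⁻ ω, liminf (fun n => ‖F n ω‖ₑ) atTop ∂μ := by
    refine lintegral_congr_ae ?_
    filter_upwards [hlim] with ω hω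
    exact hω.enorm.liminf_eq.symm
  rw [HasFiniteIntegral, h1]
  refine (lintegral_liminf_le' fun n => (hF n).aestronglyMeasurable.enorm).trans_lt ?_
  refine lt_of_le_of_lt (b := ENNReal.ofReal K) ?_ ENNReal.ofReal_lt_top
  refine (liminf_le_liminf (v := fun _ => ENNReal.ofReal K) ?_).trans_eq (liminf_const _)
  refine Eventually.of_forall fun n => ?_
  rw [← ofReal_integral_norm_eq_lintegral_enorm (hF n)]
  refine ENNReal.ofReal_le_ofReal (le_trans (le_of_eq ?_) (hK n))
  exact integral_congr_ae (ae_of_all _ fun ω => Real.norm_of_nonneg (h0 n ω))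

/-- The norm is at most twice the larger of `|Re z|` and `|Im z|`, so real exponential moments at
`±2 s` control the complex ones at `s`. -/
theorem exp_norm_le_sum_exp {s : ℝ} (hs : 0 ≤ s) (z : ℂ) :
    Real.exp (s * ‖z‖) ≤ Real.exp (2 * s * z.re) + Real.exp (-(2 * s) * z.re) +
      (Real.exp (2 * s * z.im) + Real.exp (-(2 * s) * z.im)) := by
  have key : ∀ x : ℝ, Real.exp (2 * s * |x|) ≤ Real.exp (2 * s * x) + Real.exp (-(2 * s) * x) := by
    intro x
    rcases abs_choice x with h | h <;> rw [h]
    · linarith [Real.exp_pos (-(2 * s) * x)]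
    · rw [mul_neg, ← neg_mul]
      linarith [Real.exp_pos (2 * s * x)]
  have h1 := Complex.norm_le_abs_re_add_abs_im z
  refine le_trans ?_ (add_le_add (key z.re) (key z.im))
  rcases le_total |z.re| |z.im| with h | h
  · have h2 : Real.exp (s * ‖z‖) ≤ Real.exp (2 * s * |z.im|) := by
      gcongr Real.exp ?_
      nlinarith
    linarith [Real.exp_pos (2 * s * |z.re|)]
  · have h2 : Real.exp (s * ‖z‖) ≤ Real.exp (2 * s * |z.re|) := by
      gcongr Real.exp ?_
      nlinarith
    linarith [Real.exp_pos (2 * s * |z.im|)]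

end Convergence

/-! ### Complex series: convergence and generating function -/

section ComplexSeries

variable {Ω : Type*} [MeasurableSpace Ω] {μ : Measure Ω} [IsProbabilityMeasure μ]
  {Γ : ℕ → Ω → ℝ} {c : ℕ → ℂ}

/-- The partial sums of `∑ c_k (Γ_k - 1)`. -/
noncomputable def centredSum (c : ℕ → ℂ) (Γ : ℕ → Ω → ℝ) (N : ℕ) (ω : Ω) : ℂ :=
  ∑ k ∈ Finset.range N, c k * ((Γ k ω : ℂ) - 1)

omit [MeasurableSpace Ω] in
theorem re_centredSum (c : ℕ → ℂ) (Γ : ℕ → Ω → ℝ) (N : ℕ) (ω : Ω) :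
    (centredSum c Γ N ω).re = ∑ k ∈ Finset.range N, (c k).re * (Γ k ω - 1) := by
  simp [centredSum]

omit [MeasurableSpace Ω] in
theorem im_centredSum (c : ℕ → ℂ) (Γ : ℕ → Ω → ℝ) (N : ℕ) (ω : Ω) :
    (centredSum c Γ N ω).im = ∑ k ∈ Finset.range N, (c k).im * (Γ k ω - 1) := by
  simp [centredSum]

theorem measurable_centredSum (hm : ∀ k, Measurable (Γ k)) (N : ℕ) :
    Measurable (centredSum c Γ N) := by
  unfold centredSum
  fun_prop

theorem summable_re_sq (hs : Summable fun k => ‖c k‖ ^ 2) : Summable fun k => (c k).re ^ 2 :=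
  hs.of_nonneg_of_le (fun k => sq_nonneg _) fun k => by
    rw [← sq_abs]
    gcongr
    exact Complex.abs_re_le_norm _

theorem summable_im_sq (hs : Summable fun k => ‖c k‖ ^ 2) : Summable fun k => (c k).im ^ 2 :=
  hs.of_nonneg_of_le (fun k => sq_nonneg _) fun k => by
    rw [← sq_abs]
    gcongr
    exact Complex.abs_im_le_norm _

theorem ae_exists_tendsto_centredSum (hm : ∀ k, Measurable (Γ k))
    (hΓ : ∀ k, HasLaw (Γ k) (expMeasure 1) μ) (hind : iIndepFun Γ μ) {δ : ℝ}
    (hδ : 0 < δ) (hc : ∀ k, δ * ‖c k‖ ≤ 1 / 2) (hs : Summable fun k => ‖c k‖ ^ 2) :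
    ∀ᵐ ω ∂μ, ∃ w : ℂ, Tendsto (fun N => centredSum c Γ N ω) atTop (𝓝 w) := by
  filter_upwards [ae_exists_tendsto_sum_real hm hΓ hind (r := fun k => (c k).re) hδ
      (fun k => (mul_le_mul_of_nonneg_left (Complex.abs_re_le_norm _) hδ.le).trans (hc k))
      (summable_re_sq hs),
    ae_exists_tendsto_sum_real hm hΓ hind (r := fun k => (c k).im) hδ
      (fun k => (mul_le_mul_of_nonneg_left (Complex.abs_im_le_norm _) hδ.le).trans (hc k))
      (summable_im_sq hs)] with ω ⟨x, hx⟩ ⟨y, hy⟩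
  refine ⟨x + y * Complex.I, ?_⟩
  have h := (Complex.continuous_ofReal.tendsto x |>.comp hx).add
    ((Complex.continuous_ofReal.tendsto y |>.comp hy).mul_const Complex.I)
  refine h.congr fun N => ?_
  simp only [Function.comp, ← re_centredSum, ← im_centredSum, Complex.re_add_im]

/-- The partial sums have exponential moments, uniformly. -/
theorem exists_integral_exp_norm_centredSum_le (hm : ∀ k, Measurable (Γ k))
    (hΓ : ∀ k, HasLaw (Γ k) (expMeasure 1) μ) (hind : iIndepFun Γ μ) {s : ℝ}
    (hs0 : 0 < s) (hc : ∀ k, 2 * s * ‖c k‖ ≤ 1 / 2) (hs : Summable fun k => ‖c k‖ ^ 2) :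
    ∃ K : ℝ, ∀ N, Integrable (fun ω => Real.exp (s * ‖centredSum c Γ N ω‖)) μ ∧
      ∫ ω, Real.exp (s * ‖centredSum c Γ N ω‖) ∂μ ≤ K := by
  have real : ∀ (r : ℕ → ℝ), (∀ k, |r k| ≤ ‖c k‖) → (Summable fun k => r k ^ 2) →
      ∀ σ : ℝ, |σ| = 2 * s → ∃ K : ℝ, ∀ N,
        Integrable (fun ω => Real.exp (σ * ∑ k ∈ Finset.range N, r k * (Γ k ω - 1))) μ ∧
        ∫ ω, Real.exp (σ * ∑ k ∈ Finset.range N, r k * (Γ k ω - 1)) ∂μ ≤ K := by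
    intro r hr hrs σ hσ
    have h1 : ∀ k, |σ * r k| ≤ 1 / 2 := fun k => by
      rw [abs_mul, hσ]
      exact (mul_le_mul_of_nonneg_left (hr k) (by positivity)).trans (hc k)
    have h2 : Summable fun k => (σ * r k) ^ 2 := by
      simpa only [mul_pow] using hrs.mul_left (σ ^ 2)
    refine ⟨Real.exp (2 * ∑' k, (σ * r k) ^ 2), fun N => ?_⟩
    simp only [Finset.mul_sum, ← mul_assoc]
    exact ⟨integrable_exp_sum hm hΓ hind h1 N, integral_exp_sum_le hm hΓ hind h1 h2 N⟩
  have hσ1 : |2 * s| = 2 * s := abs_of_pos (by positivity)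
  have hσ2 : |-(2 * s)| = 2 * s := by rw [abs_neg, hσ1]
  obtain ⟨K₁, h₁⟩ := real _ (fun k => Complex.abs_re_le_norm (c k)) (summable_re_sq hs) _ hσ1
  obtain ⟨K₂, h₂⟩ := real _ (fun k => Complex.abs_re_le_norm (c k)) (summable_re_sq hs) _ hσ2
  obtain ⟨K₃, h₃⟩ := real _ (fun k => Complex.abs_im_le_norm (c k)) (summable_im_sq hs) _ hσ1
  obtain ⟨K₄, h₄⟩ := real _ (fun k => Complex.abs_im_le_norm (c k)) (summable_im_sq hs) _ hσ2
  simp only [← re_centredSum, ← im_centredSum] at h₁ h₂ h₃ h₄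
  refine ⟨K₁ + K₂ + (K₃ + K₄), fun N => ?_⟩
  have hb := fun ω => exp_norm_le_sum_exp hs0.le (centredSum c Γ N ω)
  have hi := ((h₁ N).1.add (h₂ N).1).add ((h₃ N).1.add (h₄ N).1)
  have hmeas : Measurable fun ω => Real.exp (s * ‖centredSum c Γ N ω‖) := by
    have := measurable_centredSum (c := c) hm N
    fun_prop
  have hint : Integrable (fun ω => Real.exp (s * ‖centredSum c Γ N ω‖)) μ :=
    hi.mono' hmeas.aestronglyMeasurable (ae_of_all _ fun ω => by
      rw [Real.norm_of_nonneg (Real.exp_pos _).le]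
      exact hb ω)
  refine ⟨hint, (integral_mono hint hi hb).trans ?_⟩
  rw [integral_add' ((h₁ N).1.add (h₂ N).1) ((h₃ N).1.add (h₄ N).1),
    integral_add' (h₁ N).1 (h₂ N).1, integral_add' (h₃ N).1 (h₄ N).1]
  exact add_le_add (add_le_add (h₁ N).2 (h₂ N).2) (add_le_add (h₃ N).2 (h₄ N).2)

theorem integrable_exp_norm_of_tendsto_centredSum (hm : ∀ k, Measurable (Γ k))
    (hΓ : ∀ k, HasLaw (Γ k) (expMeasure 1) μ) (hind : iIndepFun Γ μ) {s : ℝ}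
    (hs0 : 0 < s) (hc : ∀ k, 2 * s * ‖c k‖ ≤ 1 / 2) (hs : Summable fun k => ‖c k‖ ^ 2)
    {W : Ω → ℂ} (hW : ∀ᵐ ω ∂μ, Tendsto (fun N => centredSum c Γ N ω) atTop (𝓝 (W ω))) :
    Integrable (fun ω => Real.exp (s * ‖W ω‖)) μ := by
  obtain ⟨K, hK⟩ := exists_integral_exp_norm_centredSum_le hm hΓ hind hs0 hc hs
  refine integrable_of_ae_tendsto_of_integral_le (fun N => (hK N).1)
    (fun N ω => (Real.exp_pos _).le) (fun N => (hK N).2) ?_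
  filter_upwards [hW] with ω hω
  exact (Real.continuous_exp.tendsto _).comp (hω.norm.const_mul s)

omit [IsProbabilityMeasure μ] in
theorem integrable_cexp_mul_of_exp_norm {s : ℝ} {W : Ω → ℂ} (hWm : AEMeasurable W μ)
    (hW : Integrable (fun ω => Real.exp (s * ‖W ω‖)) μ) {t : ℂ} (ht : ‖t‖ ≤ s) :
    Integrable (fun ω => Complex.exp (t * W ω)) μ := by
  refine hW.mono' (Complex.measurable_exp.comp_aemeasurable
    (hWm.const_mul t)).aestronglyMeasurable (ae_of_all _ fun ω => ?_)
  rw [Complex.norm_exp]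
  gcongr Real.exp ?_
  refine (Complex.re_le_norm _).trans ?_
  rw [norm_mul]
  gcongr

/-- The moment generating function of the limit is the limit of the partial products. -/
theorem tendsto_prod_integral_cexp (hm : ∀ k, Measurable (Γ k))
    (hΓ : ∀ k, HasLaw (Γ k) (expMeasure 1) μ) (hind : iIndepFun Γ μ) {s : ℝ}
    (hs0 : 0 < s) (hc : ∀ k, 2 * s * ‖c k‖ ≤ 1 / 2) (hs : Summable fun k => ‖c k‖ ^ 2)
    {W : Ω → ℂ} (hW : ∀ᵐ ω ∂μ, Tendsto (fun N => centredSum c Γ N ω) atTop (𝓝 (W ω)))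
    {t : ℂ} (ht : 2 * ‖t‖ ≤ s) :
    Tendsto (fun N => ∏ k ∈ Finset.range N, Complex.exp (-(t * c k)) * (1 - t * c k)⁻¹) atTop
      (𝓝 (∫ ω, Complex.exp (t * W ω) ∂μ)) := by
  obtain ⟨K, hK⟩ := exists_integral_exp_norm_centredSum_le hm hΓ hind hs0 hc hs
  have hWm : AEMeasurable W μ := aemeasurable_of_tendsto_metrizable_ae atTop
    (fun N => (measurable_centredSum hm N).aemeasurable) hW
  have ht' : ∀ k, (t * c k).re < 1 := fun k => by
    refine (Complex.re_le_norm _).trans_lt ?_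
    rw [norm_mul]
    nlinarith [hc k, norm_nonneg (c k), norm_nonneg t]
  -- The requirement `2 ‖t‖ ≤ s` is what bounds the squares, giving the uniform L² bound needed for
  -- the limit.
  have hb : ∀ N ω, ‖Complex.exp (t * centredSum c Γ N ω)‖ ^ 2 ≤
      Real.exp (s * ‖centredSum c Γ N ω‖) := by
    intro N ω
    rw [Complex.norm_exp, ← Real.exp_nat_mul]
    gcongr Real.exp ?_
    have h1 := Complex.re_le_norm (t * centredSum c Γ N ω)
    rw [norm_mul] at h1
    push_cast
    nlinarith [norm_nonneg (centredSum c Γ N ω)]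
  have hmeas : ∀ N, Measurable fun ω => Complex.exp (t * centredSum c Γ N ω) := fun N => by
    have := measurable_centredSum (c := c) hm N
    fun_prop
  have hi : ∀ N, Integrable (fun ω => ‖Complex.exp (t * centredSum c Γ N ω)‖ ^ 2) μ := fun N =>
    (hK N).1.mono' ((hmeas N).norm.pow_const 2).aestronglyMeasurable (ae_of_all _ fun ω => by
      rw [Real.norm_of_nonneg (by positivity)]
      exact hb N ω)
  have hlim := tendsto_integral_of_ae_tendsto_of_integral_sq_le
    (F := fun N ω => Complex.exp (t * centredSum c Γ N ω)) (f := fun ω => Complex.exp (t * W ω))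
    (fun N => (hmeas N).aestronglyMeasurable) hi
    (fun N => (integral_mono (hi N) (hK N).1 (hb N)).trans (hK N).2)
    (integrable_cexp_mul_of_exp_norm hWm (integrable_exp_norm_of_tendsto_centredSum hm hΓ hind
      hs0 hc hs hW) (by linarith [norm_nonneg t]))
    (by
      filter_upwards [hW] with ω hω
      exact (Complex.continuous_exp.tendsto _).comp (hω.const_mul t))
  refine hlim.congr fun N => ?_
  rw [← integral_cexp_sum hm hΓ hind ht' N]
  simp only [centredSum, Finset.mul_sum, mul_assoc]

end ComplexSeries

/-! ### Moments from exponential moments -/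

section Moments

variable {Ω : Type*} [MeasurableSpace Ω] {μ : Measure Ω} {s : ℝ} {W : Ω → ℂ}

theorem integrable_exp_mul_norm_add (hWm : AEMeasurable W μ)
    (hW : Integrable (fun ω => Real.exp (s * ‖W ω‖)) μ) (y : ℂ) {r : ℝ} (hr0 : 0 ≤ r)
    (hr : r ≤ s) : Integrable (fun ω => Real.exp (r * ‖y + W ω‖)) μ := by
  refine (hW.const_mul (Real.exp (s * ‖y‖))).mono' ?_ (ae_of_all _ fun ω => ?_)
  · exact (Real.measurable_exp.comp_aemeasurable
      ((hWm.const_add y).norm.const_mul r)).aestronglyMeasurable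
  · rw [Real.norm_of_nonneg (Real.exp_pos _).le, ← Real.exp_add, ← mul_add]
    gcongr Real.exp ?_
    exact mul_le_mul hr (norm_add_le y (W ω)) (norm_nonneg _) (hr0.trans hr)

theorem integrable_add_pow (hs : 0 < s) (hWm : AEMeasurable W μ)
    (hW : Integrable (fun ω => Real.exp (s * ‖W ω‖)) μ) (y : ℂ) (n : ℕ) :
    Integrable (fun ω => (y + W ω) ^ n) μ := by
  refine ((integrable_exp_mul_norm_add hWm hW y hs.le le_rfl).const_mul
    (n.factorial / s ^ n)).mono' ((hWm.const_add y).pow_const n).aestronglyMeasurable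
    (ae_of_all _ fun ω => ?_)
  have h := Real.pow_div_factorial_le_exp (s * ‖y + W ω‖) (by positivity) n
  rw [div_le_iff₀ (by positivity), mul_pow] at h
  rw [norm_pow, div_mul_eq_mul_div, le_div_iff₀ (by positivity)]
  linarith

/-- Exponential generating function of the moments. -/
theorem hasSum_moments (hs : 0 < s) (hWm : AEMeasurable W μ)
    (hW : Integrable (fun ω => Real.exp (s * ‖W ω‖)) μ) (y : ℂ) {t : ℂ} (ht : ‖t‖ ≤ s) :
    (Summable fun n : ℕ => ‖(∫ ω, (y + W ω) ^ n ∂μ) / n.factorial * t ^ n‖) ∧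
    HasSum (fun n : ℕ => (∫ ω, (y + W ω) ^ n ∂μ) / n.factorial * t ^ n)
      (∫ ω, Complex.exp (t * (y + W ω)) ∂μ) := by
  let F : ℕ → Ω → ℂ := fun n ω => (t * (y + W ω)) ^ n / n.factorial
  have hFeq : ∀ n, F n = fun ω => t ^ n / n.factorial * (y + W ω) ^ n := fun n => by
    ext ω
    simp only [F, mul_pow]
    ring
  have hFi : ∀ n, Integrable (F n) μ := fun n => by
    rw [hFeq]
    exact (integrable_add_pow hs hWm hW y n).const_mul _
  have hFint : ∀ n, ∫ ω, F n ω ∂μ = (∫ ω, (y + W ω) ^ n ∂μ) / n.factorial * t ^ n := fun n => by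
    rw [hFeq, integral_const_mul]
    ring
  -- The partial sums of the norms are dominated by `exp (‖t‖ ‖y + W‖)`, which justifies integrating
  -- the exponential series termwise.
  have hsum : Summable fun n => ∫ ω, ‖F n ω‖ ∂μ := by
    refine summable_of_sum_range_le (c := ∫ ω, Real.exp (‖t‖ * ‖y + W ω‖) ∂μ)
      (fun n => integral_nonneg fun ω => norm_nonneg _) fun N => ?_
    rw [← integral_finsetSum _ fun n _ => (hFi n).norm]
    refine integral_mono (integrable_finsetSum _ fun n _ => (hFi n).norm)
      (integrable_exp_mul_norm_add hWm hW y (norm_nonneg t) ht) fun ω => ?_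
    refine le_trans (le_of_eq ?_) (Real.sum_le_exp_of_nonneg (by positivity) N)
    simp [F]
  constructor
  · refine hsum.of_nonneg_of_le (fun n => norm_nonneg _) fun n => ?_
    rw [← hFint]
    exact norm_integral_le_integral_norm _
  · have h := hasSum_integral_of_summable_integral_norm hFi hsum
    simp only [hFint] at h
    convert! h using 3 with ω
    simp only [F]
    rw [Complex.exp_eq_exp_ℂ, NormedSpace.exp_eq_tsum_div]

end Moments

/-! ### Uniqueness of coefficients and binomial identities -/

theorem eq_of_hasSum_mul_pow {u v : ℕ → ℂ} {F : ℂ → ℂ} {r : ℝ} (hr : 0 < r)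
    (hu : ∀ t : ℂ, ‖t‖ ≤ r → HasSum (fun n => u n * t ^ n) (F t))
    (hv : ∀ t : ℂ, ‖t‖ ≤ r → HasSum (fun n => v n * t ^ n) (F t)) : u = v := by
  have key : ∀ w : ℕ → ℂ, (∀ t : ℂ, ‖t‖ ≤ r → HasSum (fun n => w n * t ^ n) (F t)) →
      HasFPowerSeriesAt F (FormalMultilinearSeries.ofScalars ℂ w) 0 := by
    intro w hw
    rw [hasFPowerSeriesAt_iff]
    filter_upwards [Metric.closedBall_mem_nhds (0 : ℂ) hr] with t ht
    simpa [FormalMultilinearSeries.coeff_ofScalars, mul_comm] using hw t (by simpa using ht)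
  have h := (key u hu).eq_formalMultilinearSeries (key v hv)
  ext n
  simpa [FormalMultilinearSeries.coeff_ofScalars] using
    congrArg (fun p => FormalMultilinearSeries.coeff p n) h

theorem Real.Gamma_add_natCast_eq_ascPochhammer {c : ℝ} (hc : 0 < c) (m : ℕ) :
    Real.Gamma (c + m) = (ascPochhammer ℝ m).eval c * Real.Gamma c := by
  induction m with
  | zero => simp
  | succ m ih =>
    rw [Nat.cast_succ, ← add_assoc, Real.Gamma_add_one (by positivity), ih,
      ascPochhammer_succ_eval]
    ring

/-- The Gamma quotients collapse to `(a + b)_n / (k! (a + b)_{n-k})` and `(a)_{n-k} / (n-k)!`, so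
the recurrence is a Cauchy product scaled by `(a + b)_n`. -/
theorem realBinom_mul_realBinom {a b : ℝ} (ha : 0 < a) (hb : 0 < b) {n k : ℕ} (hk : k ≤ n) :
    (realBinom (a + b + n - 1) k : ℂ) * (realBinom (a - 1 + (n - k)) (a - 1) : ℂ) =
      (ascPochhammer ℂ n).eval ((a : ℂ) + b) * (1 / k.factorial * kummerCoeff a b (n - k)) := by
  have hab : (a : ℂ) + b = ((a + b : ℝ) : ℂ) := by push_cast; rfl
  have hab0 : 0 < a + b := by positivity
  rw [kummerCoeff, hab, ascPochhammer_eval_ofReal, ascPochhammer_eval_ofReal,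
    ascPochhammer_eval_ofReal]
  obtain ⟨m, rfl⟩ := Nat.exists_eq_add_of_le hk
  have h1 : realBinom (a + b + ((k + m : ℕ) : ℝ) - 1) k =
      (ascPochhammer ℝ (k + m)).eval (a + b) /
        (k.factorial * (ascPochhammer ℝ m).eval (a + b)) := by
    have e1 : a + b + ((k + m : ℕ) : ℝ) - 1 + 1 = a + b + ((k + m : ℕ) : ℝ) := by ring
    have e2 : a + b + ((k + m : ℕ) : ℝ) - 1 - k + 1 = a + b + m := by push_cast; ring
    have hG := Real.Gamma_pos_of_pos hab0
    rw [realBinom, e1, e2, Real.Gamma_nat_eq_factorial,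
      Real.Gamma_add_natCast_eq_ascPochhammer hab0, Real.Gamma_add_natCast_eq_ascPochhammer hab0]
    field_simp
  have h2 : realBinom (a - 1 + (((k + m : ℕ) : ℝ) - k)) (a - 1) =
      (ascPochhammer ℝ m).eval a / m.factorial := by
    have e1 : a - 1 + (((k + m : ℕ) : ℝ) - k) + 1 = a + m := by push_cast; ring
    have e2 : a - 1 + (((k + m : ℕ) : ℝ) - k) - (a - 1) + 1 = m + 1 := by push_cast; ring
    have hG := Real.Gamma_pos_of_pos ha
    rw [realBinom, e1, e2, Real.Gamma_nat_eq_factorial,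
      Real.Gamma_add_natCast_eq_ascPochhammer ha, sub_add_cancel]
    field_simp
  have hp := (ascPochhammer_pos m (a + b) hab0).ne'
  rw [h1, h2, Nat.add_sub_cancel_left]
  push_cast
  field_simp

/-! ### The random variable attached to the Kummer zeros -/

section Kummer

variable {Ω : Type*} [MeasurableSpace Ω] {μ : Measure Ω} [IsProbabilityMeasure μ] {a b : ℝ}
  {ζ : ℕ → ℂ} {Γ : ℕ → Ω → ℝ}

omit [MeasurableSpace Ω] in
theorem zPartialSum_eq (a b : ℝ) (ζ : ℕ → ℂ) (Γ : ℕ → Ω → ℝ) (N : ℕ) (ω : Ω) :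
    zPartialSum a b ζ Γ N ω =
      -((a : ℂ) / ((a : ℂ) + b)) + centredSum (fun k => (ζ k)⁻¹) Γ N ω := by
  simp only [zPartialSum, centredSum, div_eq_inv_mul]

/-- The choice `s = 1 / 20` is dictated by `‖(ζ k)⁻¹‖ ≤ 5`. -/
theorem two_mul_norm_inv_zero_le (ha : 0 < a) (hb : 0 < b) (hζ : IsKummerZeroEnumeration a b ζ)
    (k : ℕ) : 2 * (1 / 20) * ‖(ζ k)⁻¹‖ ≤ 1 / 2 := by
  have h := one_fifth_le_norm_zero (differentiable_kummerPhi a b) (kummerPhi_zero ha hb)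
    (norm_kummerPhi_le ha hb) hζ k
  have h2 : ‖(ζ k)⁻¹‖ ≤ (1 / 5)⁻¹ := by
    rw [norm_inv]
    gcongr
  linarith

theorem summable_inv_kummer_zero_sq (ha : 0 < a) (hb : 0 < b)
    (hζ : IsKummerZeroEnumeration a b ζ) : Summable fun k => ‖(ζ k)⁻¹‖ ^ 2 :=
  summable_inv_norm_zero_sq (differentiable_kummerPhi a b) (kummerPhi_zero ha hb)
    (norm_kummerPhi_le ha hb) hζ

omit [IsProbabilityMeasure μ] in
-- `HasLaw` gives only almost everywhere measurability, while the martingale argument uses the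
-- natural filtration of measurable variables.
theorem exists_measurable_modification (hΓ : ∀ k, HasLaw (Γ k) (expMeasure 1) μ)
    (hind : iIndepFun Γ μ) :
    ∃ Γ' : ℕ → Ω → ℝ, (∀ k, Measurable (Γ' k)) ∧ (∀ k, HasLaw (Γ' k) (expMeasure 1) μ) ∧
      iIndepFun Γ' μ ∧ ∀ (c : ℕ → ℂ), ∀ᵐ ω ∂μ, ∀ N, centredSum c Γ' N ω = centredSum c Γ N ω := by
  refine ⟨fun k => (hΓ k).aemeasurable.mk, fun k => (hΓ k).aemeasurable.measurable_mk,
    fun k => (hΓ k).congr (hΓ k).aemeasurable.ae_eq_mk.symm,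
    hind.congr fun k => (hΓ k).aemeasurable.ae_eq_mk, fun c => ?_⟩
  filter_upwards [ae_all_iff.2 fun k => (hΓ k).aemeasurable.ae_eq_mk] with ω hω N
  simp only [centredSum, ← hω]

theorem ae_exists_tendsto_zPartialSum (ha : 0 < a) (hb : 0 < b)
    (hζ : IsKummerZeroEnumeration a b ζ) (hΓ : ∀ k, HasLaw (Γ k) (expMeasure 1) μ)
    (hind : iIndepFun Γ μ) :
    ∀ᵐ ω ∂μ, ∃ z : ℂ, Tendsto (fun N : ℕ => zPartialSum a b ζ Γ N ω) atTop (𝓝 z) := by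
  obtain ⟨Γ', hm, hΓ', hind', heq⟩ := exists_measurable_modification hΓ hind
  filter_upwards [heq fun k => (ζ k)⁻¹, ae_exists_tendsto_centredSum hm hΓ' hind'
    (by norm_num) (two_mul_norm_inv_zero_le ha hb hζ) (summable_inv_kummer_zero_sq ha hb hζ)]
    with ω hω ⟨w, hw⟩
  refine ⟨-((a : ℂ) / ((a : ℂ) + b)) + w, ?_⟩
  simp only [zPartialSum_eq, ← hω]
  exact hw.const_add _

/-- The limit variable has exponential moments, and its moment generating function is the
reciprocal of the Kummer function. -/
theorem exists_exponential_moments (ha : 0 < a) (hb : 0 < b)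
    (hζ : IsKummerZeroEnumeration a b ζ) (hΓ : ∀ k, HasLaw (Γ k) (expMeasure 1) μ)
    (hind : iIndepFun Γ μ) :
    AEMeasurable (zVariable a b ζ Γ) μ ∧
    Integrable (fun ω => Real.exp (1 / 20 * ‖(a : ℂ) / ((a : ℂ) + b) + zVariable a b ζ Γ ω‖)) μ ∧
    ∀ t : ℂ, ‖t‖ ≤ 1 / 40 →
      (∫ ω, Complex.exp (t * ((a : ℂ) / ((a : ℂ) + b) + zVariable a b ζ Γ ω)) ∂μ) *
        (kummerPhi a b t * Complex.exp (-((a : ℂ) / ((a : ℂ) + b) * t))) = 1 := by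
  obtain ⟨Γ', hm, hΓ', hind', heq⟩ := exists_measurable_modification hΓ hind
  set q : ℂ := (a : ℂ) / ((a : ℂ) + b) with hq
  set c : ℕ → ℂ := fun k => (ζ k)⁻¹
  have hc := two_mul_norm_inv_zero_le ha hb hζ
  have hsum := summable_inv_kummer_zero_sq ha hb hζ
  have hW : ∀ᵐ ω ∂μ, Tendsto (fun N => centredSum c Γ' N ω) atTop
      (𝓝 (q + zVariable a b ζ Γ ω)) := by
    filter_upwards [heq c, ae_exists_tendsto_zPartialSum ha hb hζ hΓ hind] with ω hω ⟨z, hz⟩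
    have h1 : zVariable a b ζ Γ ω = z := hz.limUnder_eq
    rw [h1]
    refine (hz.const_add q).congr fun N => ?_
    rw [zPartialSum_eq, hω]
    ring
  have hWm : AEMeasurable (fun ω => q + zVariable a b ζ Γ ω) μ :=
    aemeasurable_of_tendsto_metrizable_ae atTop
      (fun N => (measurable_centredSum hm N).aemeasurable) hW
  refine ⟨by simpa using hWm.const_add (-q), integrable_exp_norm_of_tendsto_centredSum hm hΓ'
    hind' (by norm_num) hc hsum hW, fun t ht => ?_⟩
  have h1 := tendsto_prod_integral_cexp hm hΓ' hind' (by norm_num) hc hsum hW (t := t)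
    (by linarith)
  have h2 := (EnumeratesZeros.hasProd hζ (differentiable_kummerPhi a b) (kummerPhi_zero ha hb)
    (norm_kummerPhi_le ha hb) t).tendsto_prod_nat
  rw [deriv_kummerPhi_zero ha hb] at h2
  -- The two partial products are reciprocal factor by factor, so their product is constantly 1.
  refine tendsto_nhds_unique (h1.mul h2) (tendsto_const_nhds.congr fun N => ?_)
  rw [← Finset.prod_mul_distrib, Finset.prod_eq_one]
  intro k _
  have hne : 1 - t * c k ≠ 0 := by
    intro h0
    have h3 : ‖t * c k‖ = 1 := by rw [← sub_eq_zero.1 h0, norm_one]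
    rw [norm_mul] at h3
    have : 2 * (1 / 20) * ‖c k‖ ≤ 1 / 2 := hc k
    nlinarith [norm_nonneg (c k), norm_nonneg t]
  change Complex.exp (-(t * c k)) * (1 - t * c k)⁻¹ * ((1 - t * c k) * Complex.exp (t * c k)) = 1
  rw [Complex.exp_neg]
  field_simp [Complex.exp_ne_zero]

/-- Comparison of Taylor coefficients in `𝔼 exp (t (x + Z)) * Φ t = exp (t x)`. -/
theorem sum_antidiagonal_hypBernoulli (ha : 0 < a) (hb : 0 < b)
    (hζ : IsKummerZeroEnumeration a b ζ) (hΓ : ∀ k, HasLaw (Γ k) (expMeasure 1) μ)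
    (hind : iIndepFun Γ μ) (n : ℕ) (x : ℂ) :
    ∑ kl ∈ Finset.HasAntidiagonal.antidiagonal n, hypBernoulli μ a b ζ Γ kl.1 x / kl.1.factorial *
      kummerCoeff a b kl.2 = x ^ n / n.factorial := by
  obtain ⟨hZm, hZ, hmgf⟩ := exists_exponential_moments ha hb hζ hΓ hind
  set q : ℂ := (a : ℂ) / ((a : ℂ) + b) with hq
  have hWm := hZm.const_add q
  -- Exponential moments are known for `q + Z`, so moments of `x + Z` are taken with base point `x -
  -- q`.
  have hshift : ∀ ω, x - q + (q + zVariable a b ζ Γ ω) = x + zVariable a b ζ Γ ω := fun ω => by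
    ring
  have key : ∀ t : ℂ, ‖t‖ ≤ 1 / 40 → HasSum (fun n : ℕ => (∑ kl ∈ Finset.HasAntidiagonal.antidiagonal n,
      hypBernoulli μ a b ζ Γ kl.1 x / kl.1.factorial * kummerCoeff a b kl.2) * t ^ n)
      (Complex.exp (x * t)) := by
    intro t ht
    obtain ⟨h1, h2⟩ := hasSum_moments (by norm_num) hWm hZ (x - q) (t := t) (by linarith)
    simp only [hshift] at h1 h2
    have h3 := summable_norm_kummerCoeff_mul_pow ha hb t
    have h4 := hasSum_kummerPhi ha hb t
    have h5 := (summable_norm_sum_mul_antidiagonal_of_summable_norm h1 h3).of_norm.hasSum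
    rw [← tsum_mul_tsum_eq_tsum_sum_antidiagonal_of_summable_norm h1 h3, h2.tsum_eq,
      h4.tsum_eq] at h5
    have h6 : (∫ ω, Complex.exp (t * (x + zVariable a b ζ Γ ω)) ∂μ) * kummerPhi a b t =
        Complex.exp (x * t) := by
      have h7 : ∀ ω, Complex.exp (t * (x + zVariable a b ζ Γ ω)) =
          Complex.exp (x * t) * Complex.exp (-(q * t)) *
            Complex.exp (t * (q + zVariable a b ζ Γ ω)) := fun ω => by
        rw [← Complex.exp_add, ← Complex.exp_add]
        ring_nf
      simp only [h7, integral_const_mul]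
      linear_combination Complex.exp (x * t) * hmgf t ht
    rw [h6] at h5
    refine h5.congr_fun fun n => ?_
    rw [Finset.sum_mul]
    refine Finset.sum_congr rfl fun kl hkl => ?_
    rw [← Finset.HasAntidiagonal.mem_antidiagonal.1 hkl, pow_add, hypBernoulli]
    ring
  have hexp : ∀ t : ℂ, ‖t‖ ≤ 1 / 40 →
      HasSum (fun n : ℕ => x ^ n / n.factorial * t ^ n) (Complex.exp (x * t)) := by
    intro t _
    have := NormedSpace.expSeries_div_hasSum_exp (x * t)
    rw [← Complex.exp_eq_exp_ℂ] at this
    simpa [mul_pow, div_mul_eq_mul_div] using this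
  exact congrFun (eq_of_hasSum_mul_pow (by norm_num) key hexp) n

end Kummer

theorem mainTheorem9 {Ω : Type*} [MeasurableSpace Ω] (μ : Measure Ω) [IsProbabilityMeasure μ]
    (a b : ℝ) (ha : 0 < a) (hb : 0 < b)
    (ζ : ℕ → ℂ) (hζ : IsKummerZeroEnumeration a b ζ)
    (Γ : ℕ → Ω → ℝ) (hΓ : ∀ k, HasLaw (Γ k) (expMeasure 1) μ) (hind : iIndepFun Γ μ) :
    (∀ᵐ ω ∂μ, ∃ z : ℂ, Tendsto (fun N : ℕ => zPartialSum a b ζ Γ N ω) atTop (𝓝 z)) ∧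
    (∀ (n : ℕ) (x : ℂ), Integrable (fun ω => (x + zVariable a b ζ Γ ω) ^ n) μ) ∧
    (∀ x : ℂ, hypBernoulli μ a b ζ Γ 0 x = 1) ∧
    (∀ n : ℕ, 1 ≤ n → ∀ x : ℂ,
      ∑ k ∈ Finset.range (n + 1),
          (realBinom (a + b + n - 1) k : ℂ) * (realBinom (a - 1 + (n - k)) (a - 1) : ℂ) *
            hypBernoulli μ a b ζ Γ k x =
        (ascPochhammer ℂ n).eval ((a : ℂ) + b) * (x ^ n / (n.factorial : ℂ))) := by
  refine ⟨ae_exists_tendsto_zPartialSum ha hb hζ hΓ hind, fun n x => ?_, fun x => ?_,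
    fun n _ x => ?_⟩
  · obtain ⟨hZm, hZ, -⟩ := exists_exponential_moments ha hb hζ hΓ hind
    have h := integrable_add_pow (by norm_num) (hZm.const_add ((a : ℂ) / ((a : ℂ) + b))) hZ
      (x - (a : ℂ) / ((a : ℂ) + b)) n
    refine h.congr (ae_of_all _ fun ω => ?_)
    simp only
    ring
  · simp [hypBernoulli]
  · rw [← sum_antidiagonal_hypBernoulli ha hb hζ hΓ hind n x,
      Finset.Nat.sum_antidiagonal_eq_sum_range_succ (fun k l =>
        hypBernoulli μ a b ζ Γ k x / k.factorial * kummerCoeff a b l), Finset.mul_sum]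
    refine Finset.sum_congr rfl fun k hk => ?_
    rw [realBinom_mul_realBinom ha hb (Nat.lt_succ_iff.1 (Finset.mem_range.1 hk))]
    ring
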